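/- **Setting.** Let $f_1,\dots,f_n:\mathbb R^d\to\mathbb R$ ($n\ge 1$) be differentiable and, for constants $L\ge\mu\ge 0$, $$\tfrac{\mu}{2}\|y-x\|^2\le f_i(y)-f_i(x)-\langle\nabla f_i(x),y-x\rangle\le\tfrac L2\|y-x\|^2\qquad(x,y\in\mathbb R^d,\ 1\le i\le n).$$ Let $f=\frac1n\sum_i f_i$ have a global minimizer $x^\star$, put $f^\star=f(x^\star)$, and let $x^0$ satisfy $\|x^0-x^\star\|^2\le\Delta$, $\Delta\ge0$. Let $C_1,\dots,C_n$ be random compressors with $\mathbb E[C_i(x)]=x$ and $\mathbb E\|C_i(x)-x\|^2\le\omega\|x\|^2$ for all $x$ (where $\omega\ge0$), such that $C_1(x_1),\dots,C_n(x_n)$ are mutually independent for all $x_1,\dots,x_n$. **Algorithm (ADIANA).** Inputs are scalars $\theta_{1,k},\theta_2,\alpha,\beta,\gamma_k,\eta_k,p$. Start from $w^0=y^0=z^0=x^0$, local shifts $h_i^0$ with $\frac1n\sum_i\|h_i^0-\nabla f_i(x^0)\|^2\le L^2\Delta$ (for instance $h_i^0=\nabla f_i(x^0)$), and $h^0=\frac1n\sum_i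 h_i^0$. For $k=0,1,2,\dots$ put $x^k=\theta_{1,k}z^k+\theta_2w^k+(1-\theta_{1,k}-\theta_2)y^k$; worker $i$ sends $m_i^k=C_i(\nabla f_i(x^k)-h_i^k)$ and $c_i^k=C_i(\nabla f_i(w^k)-h_i^k)$, with fresh independent compressor randomness in every iteration and for each of the two sets of messages, and sets $h_i^{k+1}=h_i^k+\alpha c_i^k$; the server sets $g^k=h^k+\frac1n\sum_i m_i^k$, $h^{k+1}=h^k+\frac{\alpha}{n}\sum_i c_i^k$, $y^{k+1}=x^k-\eta_kg^k$, $z^{k+1}=\beta z^k+(1-\beta)x^k+\frac{\gamma_k}{\eta_k}(y^{k+1}-x^k)$, and $w^{k+1}=y^k$ with probability $p$ and $w^{k+1}=w^k$ with probability $1-p$, by an independent coin. The output after $T$ iterations, that is after $2T$ rounds of communication, is $\hat x=w^T$ if $f(w^T)\le f(y^T)$, and $\hat x=y^T$ otherwise. **Theorem.** There is a universal constant $K>0$ such that for every $\epsilon>0$ the following holds. * *Strongly convex.* If $\mu>0$, $\kappa=L/\mu$, and $\theta_2=\frac{1}{3\sqrt n+3n/\omega}$, $\eta_k\equiv\eta=\frac{n\theta_2}{120\,\omega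 L}$, $\theta_{1,k}\equiv\theta_1=\frac1{3\sqrt\kappa}$, $\alpha=p=\frac1{1+\omega}$, $\gamma_k\equiv\frac{\eta}{2\theta_1+\eta\mu}$, $\beta=\frac{2\theta_1}{2\theta_1+\eta\mu}$ (for $\omega=0$ read as limits: $\theta_2=0$, $\eta=\frac1{360L}$), then ADIANA reaches $\mathbb E[f(\hat x)]-f^\star\le\epsilon$ within at most $$K\Big(\omega+\Big(1+\frac{\omega}{\sqrt n}\Big)\sqrt\kappa\Big)\max\Big\{\ln\frac{L\Delta}{\epsilon},0\Big\}$$ rounds of communication (with $\ln 0=-\infty$). * *Generally convex.* If $\mu=0$ and $\alpha=\frac1{1+\omega}$, $\beta=1$, $p=\theta_2=\frac1{3(1+\omega)}$, $\theta_{1,k}=\frac9{k+27(1+\omega)}$, $\gamma_k=\frac{\eta_k}{2\theta_{1,k}}$, $$\eta_k=\min\Big\{\frac{k+1+27(1+\omega)}{9(1+\omega)^2(1+27(1+\omega))L},\ \frac{3n}{200\,\omega(1+\omega)L},\ \frac1{2L}\Big\}$$ (for $\omega=0$ the second term is $+\infty$), then ADIANA reaches $\mathbb E[f(\hat x)]-f^\star\le\epsilon$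 within at most $$K\Big((1+\omega)\Big(\frac{L\Delta}{\epsilon}\Big)^{1/3}+\Big(1+\frac{\omega}{\sqrt n}\Big)\Big(\frac{L\Delta}{\epsilon}\Big)^{1/2}\Big)$$ rounds of communication. Here "reaches within $R$ rounds" means that there is a $T\ge0$ with $2T\le R$ for which the output after $T$ iterations satisfies the bound, that is, the least such number of rounds is at most $R$. -/

import Mathlib

open MeasureTheory ProbabilityTheory

noncomputable section

namespace ADIANA

/-- The space `ℝᵈ` with its Euclidean norm. -/
abbrev Vec (d : ℕ) : Type := EuclideanSpace ℝ (Fin d)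

/-- `f` is differentiable, `L`-smooth and `μ`-strongly convex (merely convex if `μ = 0`). -/
structure IsSmoothConvex {d : ℕ} (L μ : ℝ) (f : Vec d → ℝ) : Prop where
  differentiable : Differentiable ℝ f
  lower : ∀ x y : Vec d, μ / 2 * ‖y - x‖ ^ 2 ≤ f y - f x - inner ℝ (gradient f x) (y - x)
  upper : ∀ x y : Vec d, f y - f x - inner ℝ (gradient f x) (y - x) ≤ L / 2 * ‖y - x‖ ^ 2

/-- The global objective `f = (1/n) ∑ᵢ fᵢ`. -/
def objective {d n : ℕ} (f : Fin n → Vec d → ℝ) (x : Vec d) : ℝ :=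
  (1 / (n : ℝ)) * ∑ i, f i x

/-- A family of random compressors `C i : ℝᵈ → ℝᵈ`, whose joint randomness is a seed `s : S` of
law `ν`, consists of mutually independent `ω`-unbiased compressors. -/
structure IsIndepUnbiased {d n : ℕ} {S : Type*} [MeasurableSpace S] (ω : ℝ) (ν : Measure S)
    (C : Fin n → Vec d → S → Vec d) : Prop where
  measurable : ∀ i, Measurable (Function.uncurry (C i))
  unbiased : ∀ i x, Integrable (C i x) ν ∧ ∫ s, C i x s ∂ν = x
  variance : ∀ i x, Integrable (fun s => ‖C i x s - x‖ ^ 2) ν ∧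
    ∫ s, ‖C i x s - x‖ ^ 2 ∂ν ≤ ω * ‖x‖ ^ 2
  indep : ∀ x : Fin n → Vec d, iIndepFun (fun i s => C i (x i) s) ν

/-- The scalar inputs of ADIANA. -/
structure Params where
  θ₁ : ℕ → ℝ
  θ₂ : ℝ
  α : ℝ
  β : ℝ
  γ : ℕ → ℝ
  η : ℕ → ℝ
  p : ℝ

/-- The variables kept by ADIANA between iterations: `w`, `y`, `z` and the aggregated shift `h` on
the server, and the local shift `hloc i` on worker `i`. -/
structure State (d n : ℕ) where
  w : Vec d
  y : Vec d
  z : Vec d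
  h : Vec d
  hloc : Fin n → Vec d

/-- The query point `xᵏ = θ₁ₖ zᵏ + θ₂ wᵏ + (1 - θ₁ₖ - θ₂) yᵏ`. -/
def queryPoint {d n : ℕ} (q : Params) (k : ℕ) (st : State d n) : Vec d :=
  q.θ₁ k • st.z + q.θ₂ • st.w + (1 - q.θ₁ k - q.θ₂) • st.y

/-- Iteration `k` of ADIANA. The seed `s` drives the compressors for the messages `mᵢᵏ`, the seed
`s'` drives them for the messages `cᵢᵏ`, and `b` is the outcome of the coin for the `w`-update. -/
def step {d n : ℕ} {S : Type*} (q : Params) (f : Fin n → Vec d → ℝ)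
    (C : Fin n → Vec d → S → Vec d) (k : ℕ) (s s' : S) (b : Bool) (st : State d n) :
    State d n :=
  let x : Vec d := queryPoint q k st
  let m : Fin n → Vec d := fun i => C i (gradient (f i) x - st.hloc i) s
  let c : Fin n → Vec d := fun i => C i (gradient (f i) st.w - st.hloc i) s'
  let g : Vec d := st.h + (1 / (n : ℝ)) • ∑ i, m i
  let yNext : Vec d := x - q.η k • g
  { w := if b then st.y else st.w
    y := yNext
    z := q.β • st.z + (1 - q.β) • x + (q.γ k / q.η k) • (yNext - x)
    h := st.h + (q.α * (1 / (n : ℝ))) • ∑ i, c i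
    hloc := fun i => st.hloc i + q.α • c i }

/-- The state of ADIANA after `k` iterations, started from `w⁰ = y⁰ = z⁰ = x0` with local shifts
`h0 i` and with their average as the shift on the server. -/
def iterate {d n : ℕ} {S : Type*} (q : Params) (f : Fin n → Vec d → ℝ)
    (C : Fin n → Vec d → S → Vec d) (x0 : Vec d) (h0 : Fin n → Vec d)
    (ξ ξ' : ℕ → S) (b : ℕ → Bool) : ℕ → State d n
  | 0 => { w := x0, y := x0, z := x0, h := (1 / (n : ℝ)) • ∑ i, h0 i, hloc := h0 }
  | k + 1 => step q f C k (ξ k) (ξ' k) (b k) (iterate q f C x0 h0 ξ ξ' b k)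

open Classical in
/-- The output of ADIANA: the better one of `w` and `y`. -/
def output {d n : ℕ} (f : Fin n → Vec d → ℝ) (st : State d n) : Vec d :=
  if objective f st.w ≤ objective f st.y then st.w else st.y

/-- In one iteration of ADIANA every worker sends two messages to the server. -/
def communicationRounds (T : ℕ) : ℕ := 2 * T

/-- The law of a coin that shows `true` with probability `p`. -/
def coinLaw (p : ℝ) : Measure Bool :=
  ENNReal.ofReal p • Measure.dirac true + ENNReal.ofReal (1 - p) • Measure.dirac false

/-- The random inputs of a run of ADIANA: in each iteration a fresh seed `ξ k` for the messages
`mᵢᵏ`, a fresh seed `ξ' k` for the messages `cᵢᵏ` and a coin `b k` of success probability `p`, all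
of them independent. -/
structure IsRandomness {Ω S : Type*} [MeasurableSpace Ω] [MeasurableSpace S] (P : Measure Ω)
    (ν : Measure S) (p : ℝ) (ξ ξ' : ℕ → Ω → S) (b : ℕ → Ω → Bool) : Prop where
  measurable : ∀ k, Measurable (fun o => (ξ k o, ξ' k o, b k o))
  law : ∀ k, P.map (fun o => (ξ k o, ξ' k o, b k o)) = ν.prod (ν.prod (coinLaw p))
  indep : iIndepFun (fun k o => (ξ k o, ξ' k o, b k o)) P

/-- `𝔼[f(x̂)] - f(xstar) ≤ ε` for the output `x̂` after `T` iterations (the expectation exists). -/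
def IsAccurate {d n : ℕ} {Ω S : Type*} [MeasurableSpace Ω] (P : Measure Ω) (q : Params)
    (f : Fin n → Vec d → ℝ) (C : Fin n → Vec d → S → Vec d) (x0 : Vec d) (h0 : Fin n → Vec d)
    (ξ ξ' : ℕ → Ω → S) (b : ℕ → Ω → Bool) (xstar : Vec d) (ε : ℝ) (T : ℕ) : Prop :=
  let xhat : Ω → Vec d := fun o =>
    output f (iterate q f C x0 h0 (fun k => ξ k o) (fun k => ξ' k o) (fun k => b k o) T)
  Integrable (fun o => objective f (xhat o)) P ∧
    ∫ o, objective f (xhat o) ∂P - objective f xstar ≤ ε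

/-- `θ₂` in the strongly convex case. For `ω = 0` the formula is read as its limit. -/
def scθ₂ (n : ℕ) (ω : ℝ) : ℝ :=
  if ω = 0 then 0 else 1 / (3 * √(n : ℝ) + 3 * n / ω)

/-- `η` in the strongly convex case. For `ω = 0` the formula is read as its limit. -/
def scη (n : ℕ) (L ω : ℝ) : ℝ :=
  if ω = 0 then 1 / (360 * L) else n * scθ₂ n ω / (120 * ω * L)

/-- The parameters in the strongly convex case (`κ = L / μ`). -/
def scParams (n : ℕ) (L μ ω : ℝ) : Params where
  θ₁ := fun _ => 1 / (3 * √(L / μ))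
  θ₂ := scθ₂ n ω
  α := 1 / (1 + ω)
  β := 2 * (1 / (3 * √(L / μ))) / (2 * (1 / (3 * √(L / μ))) + scη n L ω * μ)
  γ := fun _ => scη n L ω / (2 * (1 / (3 * √(L / μ))) + scη n L ω * μ)
  η := fun _ => scη n L ω
  p := 1 / (1 + ω)

/-- `θ₁ₖ` in the generally convex case. -/
def gcθ₁ (ω : ℝ) (k : ℕ) : ℝ := 9 / (k + 27 * (1 + ω))

/-- `ηₖ` in the generally convex case. For `ω = 0` the second term of the minimum is `+∞`, hence
absent. -/
def gcη (n : ℕ) (L ω : ℝ) (k : ℕ) : ℝ :=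
  let a : ℝ := (k + 1 + 27 * (1 + ω)) / (9 * (1 + ω) ^ 2 * (1 + 27 * (1 + ω)) * L)
  if ω = 0 then min a (1 / (2 * L))
  else min a (min (3 * n / (200 * ω * (1 + ω) * L)) (1 / (2 * L)))

/-- The parameters in the generally convex case. -/
def gcParams (n : ℕ) (L ω : ℝ) : Params where
  θ₁ := gcθ₁ ω
  θ₂ := 1 / (3 * (1 + ω))
  α := 1 / (1 + ω)
  β := 1
  γ := fun k => gcη n L ω k / (2 * gcθ₁ ω k)
  η := gcη n L ω
  p := 1 / (3 * (1 + ω))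

end ADIANA

end

/-! The proof is a Lyapunov argument. For suitable weights, a combination of `‖z - x⋆‖²`, the gaps
of `f` at `y` and at `w`, and the mean squared error of the shifts at `w` does not increase in
expectation. The output is at least as good as `w` and `y`, so its expected gap is at most the
initial value divided by the final weight of the two gaps.

One iteration is analysed in three layers. `descent_inequality` treats the accelerated step for an
arbitrary gradient estimate. The error of the estimate enters through a linear term, which vanishes
in expectation, and a quadratic one. The gain is a pair of negative Bregman terms, between `x` and
`w` and between `x` and `y`. In `exists_bound_yz` independence of the workers divides the
compression variance by `n`; what remains is a Bregman term at `w` and the shift error. In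
`exists_bound_shift` the shift error contracts, and moving `w` to `y` costs Bregman terms again. The
negative Bregman terms pay for all of this, and `WeightsStep` lists the scalar inequalities that
express the balance. `lintegral_lyapunov_iterate_le` chains the iterations: fresh randomness is
integrated out with the current state frozen.

What is left is to choose weights. For `μ = 0` they are multiples of `ηₖ / θ₁ₖ²`, which grows at
least like the smaller of a cubic and a quadratic in `k`; these give the two terms of the rate. For
`μ > 0` they grow geometrically with ratio `1 + 1/(240 B)`, where `B` is the complexity without its
logarithm. There the initial weight of `‖z - x⋆‖²` may be of order `L (1 + ω/√n)`, but
`scWeights_initial_le` absorbs it into the weight of `w`, so that the logarithm contains only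
`LΔ/ε`. -/

noncomputable section

namespace ADIANA

/-! ### Convexity, smoothness and the deterministic accelerated step -/

section Deterministic

variable {d n : ℕ} {L μ : ℝ} {f : Fin n → Vec d → ℝ}

open scoped InnerProductSpace

/-- The average `(1/n) ∑ᵢ ∇fᵢ(x)` of the local gradients. -/
def avgGrad (f : Fin n → Vec d → ℝ) (x : Vec d) : Vec d :=
  (1 / (n : ℝ)) • ∑ i, gradient (f i) x

/-- The Bregman distance of the objective, `f(y) - f(x) - ⟨∇f(x), y - x⟩`. -/
def bregman (f : Fin n → Vec d → ℝ) (x y : Vec d) : ℝ :=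
  objective f y - objective f x - ⟪avgGrad f x, y - x⟫_ℝ

lemma bregman_eq (x y : Vec d) :
    bregman f x y = (1 / (n : ℝ)) * ∑ i, (f i y - f i x - ⟪gradient (f i) x, y - x⟫_ℝ) := by
  simp only [bregman, objective, avgGrad, inner_smul_left, sum_inner, Finset.sum_sub_distrib,
    mul_sub]
  simp

lemma avg_const (hn : 1 ≤ n) (c : ℝ) : (1 / (n : ℝ)) * ∑ _i : Fin n, c = c := by
  have : (n : ℝ) ≠ 0 := by positivity
  simp
  field_simp

lemma bregman_lower (hn : 1 ≤ n) (hf : ∀ i, IsSmoothConvex L μ (f i)) (x y : Vec d) :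
    μ / 2 * ‖y - x‖ ^ 2 ≤ bregman f x y := by
  rw [bregman_eq, ← avg_const hn (μ / 2 * ‖y - x‖ ^ 2)]
  gcongr with i
  exact (hf i).lower x y

lemma bregman_upper (hn : 1 ≤ n) (hf : ∀ i, IsSmoothConvex L μ (f i)) (x y : Vec d) :
    bregman f x y ≤ L / 2 * ‖y - x‖ ^ 2 := by
  rw [bregman_eq, ← avg_const hn (L / 2 * ‖y - x‖ ^ 2)]
  gcongr with i
  exact (hf i).upper x y

lemma bregman_nonneg (hn : 1 ≤ n) (hμ : 0 ≤ μ) (hf : ∀ i, IsSmoothConvex L μ (f i))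
    (x y : Vec d) : 0 ≤ bregman f x y :=
  le_trans (by positivity) (bregman_lower hn hf x y)

/-- Co-coercivity of the gradient of a convex `L`-smooth function. -/
lemma IsSmoothConvex.norm_gradient_sub_sq_le {φ : Vec d → ℝ} (hL : 0 < L) (hμ : 0 ≤ μ)
    (h : IsSmoothConvex L μ φ) (x y : Vec d) :
    ‖gradient φ y - gradient φ x‖ ^ 2 ≤ 2 * L * (φ y - φ x - ⟪gradient φ x, y - x⟫_ℝ) := by
  set e := gradient φ y - gradient φ x with he
  -- The test point is a gradient step of length `1/L` from `y` for the convex function `φ - ⟨∇φ(x),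
  -- ·⟩`, which is minimal at `x`.
  have h1 := h.upper y (y - (1 / L) • e)
  have h2 := h.lower x (y - (1 / L) • e)
  have h3 : 0 ≤ μ / 2 * ‖(y - (1 / L) • e) - x‖ ^ 2 := by positivity
  have e1 : y - (1 / L) • e - y = -((1 / L) • e) := by abel
  have e2 : y - (1 / L) • e - x = (y - x) - (1 / L) • e := by abel
  rw [e1, norm_neg, norm_smul, inner_neg_right, inner_smul_right, mul_pow, Real.norm_eq_abs,
    sq_abs] at h1
  rw [e2] at h2 h3
  rw [inner_sub_right, inner_smul_right] at h2
  have h4 : ⟪gradient φ y, e⟫_ℝ - ⟪gradient φ x, e⟫_ℝ = ‖e‖ ^ 2 := by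
    rw [← inner_sub_left, ← he, real_inner_self_eq_norm_sq]
  have h5 : (1 / L) * (⟪gradient φ y, e⟫_ℝ - ⟪gradient φ x, e⟫_ℝ) - L / 2 * ((1 / L) ^ 2 * ‖e‖ ^ 2)
      ≤ φ y - φ x - ⟪gradient φ x, y - x⟫_ℝ := by linarith
  rw [h4] at h5
  have h6 : (1 / L) * ‖e‖ ^ 2 - L / 2 * ((1 / L) ^ 2 * ‖e‖ ^ 2) = ‖e‖ ^ 2 / (2 * L) := by
    field_simp; ring
  rw [h6, div_le_iff₀ (by positivity)] at h5
  linarith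

/-- Co-coercivity and the quadratic upper bound together make the gradient `L`-Lipschitz. Continuity
is what later makes the iterates measurable. -/
lemma IsSmoothConvex.continuous_gradient {φ : Vec d → ℝ} (hL : 0 < L) (hμ : 0 ≤ μ)
    (h : IsSmoothConvex L μ φ) : Continuous (gradient φ) := by
  refine LipschitzWith.continuous (K := L.toNNReal) (LipschitzWith.of_dist_le_mul fun x y => ?_)
  rw [dist_eq_norm, dist_eq_norm, Real.coe_toNNReal _ hL.le]
  have h1 := h.norm_gradient_sub_sq_le hL hμ y x
  have h2 := h.upper y x
  refine abs_le_of_sq_le_sq' ?_ (by positivity) |>.2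
  nlinarith

lemma avg_norm_gradient_sub_sq_le (hL : 0 < L) (hμ : 0 ≤ μ)
    (hf : ∀ i, IsSmoothConvex L μ (f i)) (x y : Vec d) :
    (1 / (n : ℝ)) * ∑ i, ‖gradient (f i) y - gradient (f i) x‖ ^ 2 ≤ 2 * L * bregman f x y := by
  rw [bregman_eq, mul_left_comm (2 * L), Finset.mul_sum _ _ (2 * L)]
  gcongr with i
  exact (hf i).norm_gradient_sub_sq_le hL hμ x y

lemma IsSmoothConvex.mono {φ : Vec d → ℝ} {L' : ℝ} (h : IsSmoothConvex L μ φ) (hL : L ≤ L') :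
    IsSmoothConvex L' μ φ where
  differentiable := h.differentiable
  lower := h.lower
  upper x y := (h.upper x y).trans (by gcongr)

/-- A gradient step of length `1/L` from the minimizer would lower `f` by `‖avgGrad‖² / (2L)`. -/
lemma avgGrad_minimizer (hn : 1 ≤ n) (hL : 0 < L) (hf : ∀ i, IsSmoothConvex L μ (f i))
    {xstar : Vec d} (hmin : ∀ x, objective f xstar ≤ objective f x) : avgGrad f xstar = 0 := by
  have h1 := bregman_upper hn hf xstar (xstar - (1 / L) • avgGrad f xstar)
  have h2 := hmin (xstar - (1 / L) • avgGrad f xstar)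
  have e1 : xstar - (1 / L) • avgGrad f xstar - xstar = -((1 / L) • avgGrad f xstar) := by abel
  rw [bregman, e1, norm_neg, norm_smul, inner_neg_right, inner_smul_right, mul_pow,
    Real.norm_eq_abs, sq_abs, real_inner_self_eq_norm_sq] at h1
  have h6 : (1 / L) * ‖avgGrad f xstar‖ ^ 2 - L / 2 * ((1 / L) ^ 2 * ‖avgGrad f xstar‖ ^ 2)
      = ‖avgGrad f xstar‖ ^ 2 / (2 * L) := by
    field_simp; ring
  have h7 : ‖avgGrad f xstar‖ ^ 2 / (2 * L) ≤ 0 := by linarith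
  have h8 : ‖avgGrad f xstar‖ ^ 2 ≤ 0 := by
    rw [div_le_iff₀ (by positivity)] at h7; linarith
  have h9 : ‖avgGrad f xstar‖ = 0 := by
    have := sq_nonneg ‖avgGrad f xstar‖
    exact pow_eq_zero_iff (two_ne_zero) |>.1 (le_antisymm h8 this)
  simpa using h9

lemma objective_sub_minimizer_le (hn : 1 ≤ n) (hL : 0 ≤ L)
    (hf : ∀ i, IsSmoothConvex L μ (f i)) {xstar : Vec d}
    (hmin : ∀ x, objective f xstar ≤ objective f x) (x : Vec d) :
    objective f x - objective f xstar ≤ L / 2 * ‖x - xstar‖ ^ 2 := by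
  have h1 := bregman_upper hn hf xstar x
  -- `L` may vanish here, while the first-order condition was derived for a positive constant.
  rw [bregman, avgGrad_minimizer hn (L := L + 1) (by linarith)
    (fun i => (hf i).mono (by linarith)) hmin, inner_zero_left] at h1
  linarith

lemma norm_convex_comb_sq_le (β : ℝ) (h0 : 0 ≤ β) (h1 : β ≤ 1) (u v : Vec d) :
    ‖β • u + (1 - β) • v‖ ^ 2 ≤ β * ‖u‖ ^ 2 + (1 - β) * ‖v‖ ^ 2 := by
  have h2 : ‖β • u + (1 - β) • v‖ ^ 2
      = β * ‖u‖ ^ 2 + (1 - β) * ‖v‖ ^ 2 - β * (1 - β) * ‖u - v‖ ^ 2 := by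
    rw [norm_add_sq_real, norm_sub_sq_real, norm_smul, norm_smul, inner_smul_left,
      inner_smul_right, mul_pow, mul_pow, Real.norm_eq_abs, Real.norm_eq_abs, sq_abs, sq_abs]
    simp only [conj_trivial]
    ring
  have h3 : 0 ≤ β * (1 - β) * ‖u - v‖ ^ 2 :=
    mul_nonneg (mul_nonneg h0 (by linarith)) (sq_nonneg _)
  linarith

/-- The deterministic part of the one-step analysis of the `y`- and `z`-updates, for an arbitrary
gradient estimate `g`. The error of the estimate enters through a linear and a quadratic term. -/
lemma descent_inequality (hn : 1 ≤ n) (hμ : 0 ≤ μ)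
    (hf : ∀ i, IsSmoothConvex L μ (f i)) {xstar : Vec d}
    (hmin : ∀ x, objective f xstar ≤ objective f x) {θ₁ θ₂ η : ℝ} (hθ₁ : 0 < θ₁) (hη : 0 < η)
    (hηL : η * L ≤ 1 / 2) (x w y z : Vec d)
    (hx : x = θ₁ • z + θ₂ • w + (1 - θ₁ - θ₂) • y) :
    ∃ a : Vec d, ∀ g : Vec d,
      (2 * θ₁ + η * μ) ^ 2 / (4 * η) *
          ‖(2 * θ₁ / (2 * θ₁ + η * μ)) • z + (1 - 2 * θ₁ / (2 * θ₁ + η * μ)) • x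
            - (η / (2 * θ₁ + η * μ)) • g - xstar‖ ^ 2
        + (objective f (x - η • g) - objective f xstar)
      ≤ θ₁ * (2 * θ₁ + η * μ) / (2 * η) * ‖z - xstar‖ ^ 2
        + θ₂ * (objective f w - objective f xstar)
        + (1 - θ₁ - θ₂) * (objective f y - objective f xstar)
        - θ₂ * bregman f x w - (1 - θ₁ - θ₂) * bregman f x y
        + ⟪a, g - avgGrad f x⟫_ℝ + η / 2 * ‖g - avgGrad f x‖ ^ 2 := by
  set q := 2 * θ₁ + η * μ with hq
  have hqpos : 0 < q := by positivity
  have hqθ : 2 * θ₁ ≤ q := by have := mul_nonneg hη.le hμ; linarith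
  set β := 2 * θ₁ / q with hβ
  have hβ0 : 0 ≤ β := by positivity
  have hβ1 : β ≤ 1 := (div_le_one hqpos).2 hqθ
  set G := avgGrad f x with hG
  set v := β • z + (1 - β) • x - xstar with hv
  have hqβ : q * β = 2 * θ₁ := by rw [hβ]; field_simp
  -- The coefficients of `e = g - G` in the expansion: `η/2` from the quadratic term of the
  -- `z`-update, `Lη²` and `-η` from smoothness along the `y`-update, `-(q/2) v` from the cross term
  -- of the `z`-update.
  refine ⟨(η / 2) • G + (L * η ^ 2) • G - η • G - (q / 2) • v, fun g => ?_⟩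
  -- the point `v`
  have hv1 : ‖v‖ ^ 2 ≤ β * ‖z - xstar‖ ^ 2 + (1 - β) * ‖x - xstar‖ ^ 2 := by
    have : v = β • (z - xstar) + (1 - β) • (x - xstar) := by rw [hv]; module
    rw [this]; exact norm_convex_comb_sq_le β hβ0 hβ1 _ _
  -- The coupling: since `(q/2) β = θ₁`, the definition of `x` trades `z` for `w` and `y`.
  have hv2 : (q / 2) • v = (q / 2) • (x - xstar) + θ₂ • (x - w) + (1 - θ₁ - θ₂) • (x - y) := by
    have h1 : θ₂ • (x - w) + (1 - θ₁ - θ₂) • (x - y) = θ₁ • (z - x) := by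
      have h2 : θ₂ • w + (1 - θ₁ - θ₂) • y = x - θ₁ • z := by rw [hx]; module
      have h3 : θ₂ • (x - w) + (1 - θ₁ - θ₂) • (x - y)
        = (1 - θ₁) • x - (θ₂ • w + (1 - θ₁ - θ₂) • y) := by module
      rw [h3, h2]; module
    have h4 : θ₁ = (q / 2) * β := by linarith
    rw [add_assoc, h1, hv]
    nth_rewrite 1 [h4]
    module
  have hGv : (q / 2) * ⟪G, v⟫_ℝ = (q / 2) * ⟪G, x - xstar⟫_ℝ + θ₂ * ⟪G, x - w⟫_ℝ
      + (1 - θ₁ - θ₂) * ⟪G, x - y⟫_ℝ := by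
    rw [← inner_smul_right, hv2]
    simp only [inner_add_right, inner_smul_right]
  have breg : ∀ u, ⟪G, x - u⟫_ℝ = objective f x - objective f u + bregman f x u := by
    intro u
    rw [bregman, ← neg_sub x u, inner_neg_right]; ring
  have hz : ‖β • z + (1 - β) • x - (η / q) • g - xstar‖ ^ 2
      = ‖v‖ ^ 2 - 2 * (η / q) * ⟪g, v⟫_ℝ + (η / q) ^ 2 * ‖g‖ ^ 2 := by
    have : β • z + (1 - β) • x - (η / q) • g - xstar = v - (η / q) • g := by rw [hv]; abel
    rw [this, norm_sub_sq_real, norm_smul, inner_smul_right, mul_pow, Real.norm_eq_abs, sq_abs,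
      real_inner_comm]
    ring
  have hy : objective f (x - η • g)
      ≤ objective f x - η * ⟪G, g⟫_ℝ + L / 2 * (η ^ 2 * ‖g‖ ^ 2) := by
    have h1 := bregman_upper hn hf x (x - η • g)
    have e1 : x - η • g - x = -(η • g) := by abel
    rw [bregman, e1, norm_neg, norm_smul, inner_neg_right, inner_smul_right, mul_pow,
      Real.norm_eq_abs, sq_abs, ← hG] at h1
    linarith
  set e := g - G with he
  have hge : g = G + e := by rw [he]; abel
  have hgn : ‖g‖ ^ 2 = ‖G‖ ^ 2 + 2 * ⟪G, e⟫_ℝ + ‖e‖ ^ 2 := by rw [hge, norm_add_sq_real]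
  have hGg : ⟪G, g⟫_ℝ = ‖G‖ ^ 2 + ⟪G, e⟫_ℝ := by
    rw [hge, inner_add_right, real_inner_self_eq_norm_sq]
  have hgv : ⟪g, v⟫_ℝ = ⟪G, v⟫_ℝ + ⟪v, e⟫_ℝ := by rw [hge, inner_add_left, real_inner_comm v e]
  have hae : ⟪(η / 2) • G + (L * η ^ 2) • G - η • G - (q / 2) • v, e⟫_ℝ
      = (η / 2 + L * η ^ 2 - η) * ⟪G, e⟫_ℝ - (q / 2) * ⟪v, e⟫_ℝ := by
    simp only [inner_add_left, inner_sub_left, inner_smul_left, conj_trivial]; ring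
  rw [hz, hae]
  have hA : q ^ 2 / (4 * η) * (‖v‖ ^ 2 - 2 * (η / q) * ⟪g, v⟫_ℝ + (η / q) ^ 2 * ‖g‖ ^ 2)
      = q ^ 2 / (4 * η) * ‖v‖ ^ 2 - (q / 2) * ⟪g, v⟫_ℝ + η / 4 * ‖g‖ ^ 2 := by
    field_simp; ring
  rw [hA]
  have hv3 : q ^ 2 / (4 * η) * ‖v‖ ^ 2
      ≤ θ₁ * q / (2 * η) * ‖z - xstar‖ ^ 2 + q * μ / 4 * ‖x - xstar‖ ^ 2 := by
    calc q ^ 2 / (4 * η) * ‖v‖ ^ 2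
        ≤ q ^ 2 / (4 * η) * (β * ‖z - xstar‖ ^ 2 + (1 - β) * ‖x - xstar‖ ^ 2) := by gcongr
      _ = q / (4 * η) * (q * β) * ‖z - xstar‖ ^ 2
          + q / (4 * η) * (q - q * β) * ‖x - xstar‖ ^ 2 := by field_simp
      _ = _ := by rw [hqβ, hq]; field_simp; ring
  -- Strong convexity yields exactly the term `qμ/4 ‖x - x⋆‖²` that `hv3` has to pay. The surplus
  -- `q/2 - θ₁` of the gap at `x` is nonnegative and dropped.
  have hst : (q / 2) * ⟪G, x - xstar⟫_ℝ
      ≥ θ₁ * (objective f x - objective f xstar) + q * μ / 4 * ‖x - xstar‖ ^ 2 := by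
    rw [breg]
    have h1 := bregman_lower hn hf x xstar
    rw [norm_sub_rev] at h1
    have h2 := hmin x
    have h3 := mul_le_mul_of_nonneg_left h1 (by positivity : 0 ≤ q / 2)
    have h4 := mul_nonneg (by linarith : 0 ≤ q / 2 - θ₁) (sub_nonneg.2 h2)
    linarith
  rw [breg w, breg y] at hGv
  rw [hgv, hgn]
  rw [hGg, hgn] at hy
  -- With this, the total coefficient of `‖G‖²` is at most `η/4 - η + η/4 < 0`, and that of `‖e‖²`
  -- at most `η/4 + η/4`.
  have hηη : L * η ^ 2 ≤ η / 2 := by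
    have := mul_le_mul_of_nonneg_left hηL hη.le
    linarith
  have hG2 : L * η ^ 2 * ‖G‖ ^ 2 ≤ η / 2 * ‖G‖ ^ 2 := by gcongr
  have he2 : L * η ^ 2 * ‖e‖ ^ 2 ≤ η / 2 * ‖e‖ ^ 2 := by gcongr
  have hGp : 0 ≤ η * ‖G‖ ^ 2 := by positivity
  linarith

end Deterministic

/-! ### Expected progress of one iteration -/

section Expectation

open scoped InnerProductSpace

variable {d n : ℕ} {L μ ω : ℝ} {f : Fin n → Vec d → ℝ} {S : Type*} [MeasurableSpace S]
  {ν : Measure S} {C : Fin n → Vec d → S → Vec d}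

lemma IsIndepUnbiased.integrable_error [IsProbabilityMeasure ν] (hC : IsIndepUnbiased ω ν C)
    (i : Fin n) (v : Vec d) : Integrable (fun s => C i v s - v) ν :=
  (hC.unbiased i v).1.sub (integrable_const _)

lemma IsIndepUnbiased.integral_error [IsProbabilityMeasure ν] (hC : IsIndepUnbiased ω ν C)
    (i : Fin n) (v : Vec d) : ∫ s, (C i v s - v) ∂ν = 0 := by
  rw [integral_sub (hC.unbiased i v).1 (integrable_const _), (hC.unbiased i v).2]
  simp

lemma IsIndepUnbiased.inner_error [IsProbabilityMeasure ν] (hC : IsIndepUnbiased ω ν C)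
    (v : Fin n → Vec d) {i j : Fin n} (hij : i ≠ j) :
    Integrable (fun s => ⟪C i (v i) s - v i, C j (v j) s - v j⟫_ℝ) ν ∧
      ∫ s, ⟪C i (v i) s - v i, C j (v j) s - v j⟫_ℝ ∂ν = 0 := by
  have hind : IndepFun (fun s => C i (v i) s - v i) (fun s => C j (v j) s - v j) ν :=
    ((hC.indep v).indepFun hij).comp (φ := fun u => u - v i) (ψ := fun u => u - v j)
      (measurable_id.sub_const _) (measurable_id.sub_const _)
  refine ⟨hind.integrable_bilin (hC.integrable_error i (v i)) (hC.integrable_error j (v j))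
    (innerSL ℝ), ?_⟩
  have h := hind.integral_bilin (hC.integrable_error i (v i)) (hC.integrable_error j (v j))
    (innerSL ℝ)
  rw [hC.integral_error i] at h
  exact h.trans (by simp)

/-- Expanding the square, the off-diagonal terms vanish by independence and unbiasedness. This is
the source of the factor `1/n`. -/
lemma IsIndepUnbiased.variance_avg [IsProbabilityMeasure ν] (hC : IsIndepUnbiased ω ν C)
    (v : Fin n → Vec d) :
    Integrable (fun s => ‖(1 / (n : ℝ)) • ∑ i, (C i (v i) s - v i)‖ ^ 2) ν ∧
      ∫ s, ‖(1 / (n : ℝ)) • ∑ i, (C i (v i) s - v i)‖ ^ 2 ∂ν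
        ≤ ω / n * ((1 / (n : ℝ)) * ∑ i, ‖v i‖ ^ 2) := by
  have hint : ∀ i j, Integrable (fun s => ⟪C i (v i) s - v i, C j (v j) s - v j⟫_ℝ) ν := by
    intro i j
    by_cases hij : i = j
    · subst hij
      simpa only [real_inner_self_eq_norm_sq] using (hC.variance i (v i)).1
    · exact (hC.inner_error v hij).1
  have heq : ∀ s, ‖(1 / (n : ℝ)) • ∑ i, (C i (v i) s - v i)‖ ^ 2
      = (1 / (n : ℝ)) ^ 2 * ∑ i, ∑ j, ⟪C i (v i) s - v i, C j (v j) s - v j⟫_ℝ := by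
    intro s
    rw [norm_smul, mul_pow, Real.norm_eq_abs, sq_abs, ← real_inner_self_eq_norm_sq, sum_inner]
    simp only [inner_sum]
  simp only [heq]
  refine ⟨(integrable_finsetSum _ fun i _ => integrable_finsetSum _ fun j _ =>
    hint i j).const_mul _, ?_⟩
  rw [integral_const_mul, integral_finsetSum _ fun i _ => integrable_finsetSum _ fun j _ =>
    hint i j]
  have hsum : ∀ i, ∫ s, ∑ j, ⟪C i (v i) s - v i, C j (v j) s - v j⟫_ℝ ∂ν ≤ ω * ‖v i‖ ^ 2 := by
    intro i
    rw [integral_finsetSum _ fun j _ => hint i j, Finset.sum_eq_single i]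
    · simpa only [real_inner_self_eq_norm_sq] using (hC.variance i (v i)).2
    · intro j _ hj
      exact (hC.inner_error v hj.symm).2
    · simp
  calc (1 / (n : ℝ)) ^ 2 * ∑ i, ∫ s, ∑ j, ⟪C i (v i) s - v i, C j (v j) s - v j⟫_ℝ ∂ν
      ≤ (1 / (n : ℝ)) ^ 2 * ∑ i, ω * ‖v i‖ ^ 2 := by
        gcongr with i
        exact hsum i
    _ = _ := by rw [← Finset.mul_sum]; ring

/-- The new error splits into a mean-zero part of variance at most `α²ω‖g - h‖²` and a bias `(1-α)(g
- h)`; for `α = 1/(1+ω)` one has `α²ω + (1-α)² = 1 - α`. -/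
lemma IsIndepUnbiased.shift_contraction [IsProbabilityMeasure ν] (hC : IsIndepUnbiased ω ν C)
    (hω : 0 ≤ ω) (i : Fin n) (h g : Vec d) :
    Integrable (fun s => ‖h + (1 / (1 + ω)) • C i (g - h) s - g‖ ^ 2) ν ∧
      ∫ s, ‖h + (1 / (1 + ω)) • C i (g - h) s - g‖ ^ 2 ∂ν
        ≤ (1 - 1 / (1 + ω)) * ‖h - g‖ ^ 2 := by
  set α := 1 / (1 + ω) with hα
  set v := g - h with hv
  have heq : ∀ s, ‖h + α • C i v s - g‖ ^ 2
      = α ^ 2 * ‖C i v s - v‖ ^ 2 - 2 * α * (1 - α) * ⟪v, C i v s - v⟫_ℝ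
        + (1 - α) ^ 2 * ‖v‖ ^ 2 := by
    intro s
    have : h + α • C i v s - g = α • (C i v s - v) - (1 - α) • v := by rw [hv]; module
    rw [this, norm_sub_sq_real, norm_smul, norm_smul, inner_smul_left, inner_smul_right,
      mul_pow, mul_pow, Real.norm_eq_abs, Real.norm_eq_abs, sq_abs, sq_abs, real_inner_comm]
    simp only [conj_trivial]
    ring
  simp only [heq]
  have i1 := ((hC.variance i v).1.const_mul (α ^ 2))
  have i2 : Integrable (fun s => 2 * α * (1 - α) * ⟪v, C i v s - v⟫_ℝ) ν :=
    ((hC.integrable_error i v).const_inner v).const_mul _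
  have i12 : Integrable (fun s => α ^ 2 * ‖C i v s - v‖ ^ 2
      - 2 * α * (1 - α) * ⟪v, C i v s - v⟫_ℝ) ν := i1.sub i2
  refine ⟨i12.add (integrable_const _), ?_⟩
  rw [integral_add i12 (integrable_const _), integral_sub i1 i2, integral_const_mul,
    integral_const_mul, integral_inner (hC.integrable_error i v), hC.integral_error,
    inner_zero_right, norm_sub_rev h g, ← hv]
  have h1 : α ^ 2 * ∫ s, ‖C i v s - v‖ ^ 2 ∂ν ≤ α ^ 2 * (ω * ‖v‖ ^ 2) := by
    gcongr
    exact (hC.variance i v).2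
  have h2 : α ^ 2 * ω + (1 - α) ^ 2 = 1 - α := by
    rw [hα]; field_simp; ring
  simp only [integral_const, probReal_univ, smul_eq_mul, one_mul, mul_zero, sub_zero]
  calc _ ≤ (α ^ 2 * ω + (1 - α) ^ 2) * ‖v‖ ^ 2 := by linarith
    _ = _ := by rw [h2]

lemma lintegral_coinLaw (p : ℝ) (φ : Bool → ENNReal) :
    ∫⁻ b, φ b ∂(coinLaw p) = ENNReal.ofReal p * φ true + ENNReal.ofReal (1 - p) * φ false := by
  simp [coinLaw, lintegral_add_measure, lintegral_smul_measure]

/-- The average squared distance of the local shifts from the local gradients at `w`. -/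
def shiftDist (f : Fin n → Vec d → ℝ) (st : State d n) : ℝ :=
  (1 / (n : ℝ)) * ∑ i, ‖st.hloc i - gradient (f i) st.w‖ ^ 2

/-- The relations between the scalar inputs in iteration `k` on which the analysis rests. -/
structure Params.Admissible (q : Params) (L μ ω : ℝ) (k : ℕ) : Prop where
  θ₁_pos : 0 < q.θ₁ k
  η_pos : 0 < q.η k
  η_mul_le : q.η k * L ≤ 1 / 2
  β_eq : q.β = 2 * q.θ₁ k / (2 * q.θ₁ k + q.η k * μ)
  γ_eq : q.γ k = q.η k / (2 * q.θ₁ k + q.η k * μ)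
  α_eq : q.α = 1 / (1 + ω)
  p_nonneg : 0 ≤ q.p
  p_le : q.p ≤ 1 / (1 + ω)

lemma norm_add_sq_le_two_mul (u v : Vec d) : ‖u + v‖ ^ 2 ≤ 2 * ‖u‖ ^ 2 + 2 * ‖v‖ ^ 2 := by
  have h1 := norm_add_sq_real u v
  have h2 := norm_sub_sq_real u v
  have h3 := sq_nonneg ‖u - v‖
  linarith

lemma norm_add_sq_le_three_halves (u v : Vec d) :
    ‖u + v‖ ^ 2 ≤ 3 / 2 * ‖u‖ ^ 2 + 3 * ‖v‖ ^ 2 := by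
  have h1 := norm_add_sq_real u v
  have h2 := norm_sub_sq_real u ((2 : ℝ) • v)
  have h3 := sq_nonneg ‖u - (2 : ℝ) • v‖
  rw [inner_smul_right, norm_smul, mul_pow, Real.norm_eq_abs, sq_abs] at h2
  linarith

/-- The shifts track the gradients at `w`, so the error at `x` is split at the gradient at `w`;
co-coercivity turns the difference of gradients into a Bregman distance. -/
lemma avg_error_at_query_le (hL : 0 < L) (hμ : 0 ≤ μ)
    (hf : ∀ i, IsSmoothConvex L μ (f i)) (st : State d n) (x : Vec d) :
    (1 / (n : ℝ)) * ∑ i, ‖gradient (f i) x - st.hloc i‖ ^ 2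
      ≤ 4 * L * bregman f x st.w + 2 * shiftDist f st := by
  have h1 := avg_norm_gradient_sub_sq_le hL hμ hf x st.w
  have h2 : (1 / (n : ℝ)) * ∑ i, ‖gradient (f i) x - st.hloc i‖ ^ 2
      ≤ (1 / (n : ℝ)) * ∑ i, (2 * ‖gradient (f i) st.w - gradient (f i) x‖ ^ 2
        + 2 * ‖st.hloc i - gradient (f i) st.w‖ ^ 2) := by
    gcongr with i
    have := norm_add_sq_le_two_mul (gradient (f i) st.w - gradient (f i) x)
      (st.hloc i - gradient (f i) st.w)
    rwa [show gradient (f i) st.w - gradient (f i) x + (st.hloc i - gradient (f i) st.w)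
      = -(gradient (f i) x - st.hloc i) by abel, norm_neg] at this
  rw [Finset.sum_add_distrib, ← Finset.mul_sum, ← Finset.mul_sum] at h2
  unfold shiftDist
  linarith

lemma avg_gradient_diff_le (hL : 0 < L) (hμ : 0 ≤ μ)
    (hf : ∀ i, IsSmoothConvex L μ (f i)) (x w y : Vec d) :
    (1 / (n : ℝ)) * ∑ i, ‖gradient (f i) w - gradient (f i) y‖ ^ 2
      ≤ 4 * L * (bregman f x w + bregman f x y) := by
  have h1 := avg_norm_gradient_sub_sq_le hL hμ hf x w
  have h3 := avg_norm_gradient_sub_sq_le hL hμ hf x y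
  have h2 : (1 / (n : ℝ)) * ∑ i, ‖gradient (f i) w - gradient (f i) y‖ ^ 2
      ≤ (1 / (n : ℝ)) * ∑ i, (2 * ‖gradient (f i) w - gradient (f i) x‖ ^ 2
        + 2 * ‖gradient (f i) y - gradient (f i) x‖ ^ 2) := by
    gcongr with i
    have := norm_add_sq_le_two_mul (gradient (f i) w - gradient (f i) x)
      (-(gradient (f i) y - gradient (f i) x))
    rwa [show gradient (f i) w - gradient (f i) x + -(gradient (f i) y - gradient (f i) x)
      = gradient (f i) w - gradient (f i) y by abel, norm_neg] at this
  rw [Finset.sum_add_distrib, ← Finset.mul_sum, ← Finset.mul_sum] at h2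
  linarith

/-- Expected progress of the `y`- and `z`-updates. -/
lemma exists_bound_yz [IsProbabilityMeasure ν] (hC : IsIndepUnbiased ω ν C) (hn : 1 ≤ n)
    (hL : 0 < L) (hμ : 0 ≤ μ) (hω : 0 ≤ ω) (hf : ∀ i, IsSmoothConvex L μ (f i)) {xstar : Vec d}
    (hmin : ∀ x, objective f xstar ≤ objective f x) {q : Params} {k : ℕ}
    (hq : q.Admissible L μ ω k) (st : State d n) (hst : st.h = (1 / (n : ℝ)) • ∑ i, st.hloc i) :
    ∃ Q : S → ℝ, Integrable Q ν ∧
      (∀ s s' b, (2 * q.θ₁ k + q.η k * μ) ^ 2 / (4 * q.η k) *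
          ‖(step q f C k s s' b st).z - xstar‖ ^ 2
          + (objective f (step q f C k s s' b st).y - objective f xstar) ≤ Q s) ∧
      ∫ s, Q s ∂ν ≤ q.θ₁ k * (2 * q.θ₁ k + q.η k * μ) / (2 * q.η k) * ‖st.z - xstar‖ ^ 2
        + q.θ₂ * (objective f st.w - objective f xstar)
        + (1 - q.θ₁ k - q.θ₂) * (objective f st.y - objective f xstar)
        - q.θ₂ * bregman f (queryPoint q k st) st.w
        - (1 - q.θ₁ k - q.θ₂) * bregman f (queryPoint q k st) st.y
        + q.η k * (ω / n) * (2 * L * bregman f (queryPoint q k st) st.w + shiftDist f st) := by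
  set x := queryPoint q k st with hx
  obtain ⟨a, ha⟩ := descent_inequality hn hμ hf hmin hq.θ₁_pos hq.η_pos hq.η_mul_le x st.w st.y
    st.z hx
  set v : Fin n → Vec d := fun i => gradient (f i) x - st.hloc i with hv
  set e : S → Vec d := fun s => (1 / (n : ℝ)) • ∑ i, (C i (v i) s - v i) with he
  set c₀ : ℝ := q.θ₁ k * (2 * q.θ₁ k + q.η k * μ) / (2 * q.η k) * ‖st.z - xstar‖ ^ 2
        + q.θ₂ * (objective f st.w - objective f xstar)
        + (1 - q.θ₁ k - q.θ₂) * (objective f st.y - objective f xstar)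
        - q.θ₂ * bregman f x st.w - (1 - q.θ₁ k - q.θ₂) * bregman f x st.y with hc₀
  obtain ⟨hvi, hvle⟩ := hC.variance_avg v
  have hei : Integrable e ν :=
    (integrable_finsetSum _ fun i _ => hC.integrable_error i (v i)).smul (1 / (n : ℝ))
  have he0 : ∫ s, e s ∂ν = 0 := by
    rw [he, integral_smul, integral_finsetSum _ fun i _ => hC.integrable_error i (v i)]
    simp [hC.integral_error]
  have i1 : Integrable (fun s => c₀ + ⟪a, e s⟫_ℝ) ν := (integrable_const _).add (hei.const_inner a)
  have i2 : Integrable (fun s => q.η k / 2 * ‖e s‖ ^ 2) ν := hvi.const_mul _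
  -- `a` does not depend on the estimate, so the linear term integrates to zero. The bound involves
  -- the first seed only, not `s'` or the coin.
  refine ⟨fun s => c₀ + ⟪a, e s⟫_ℝ + q.η k / 2 * ‖e s‖ ^ 2, i1.add i2, ?_, ?_⟩
  · intro s s' b
    have hη := hq.η_pos.ne'
    have hg : st.h + (1 / (n : ℝ)) • ∑ i, C i (v i) s - avgGrad f x = e s := by
      rw [he, hst, avgGrad]
      simp only [hv, Finset.sum_sub_distrib, smul_sub]
      abel
    have h1 := ha (st.h + (1 / (n : ℝ)) • ∑ i, C i (v i) s)
    rw [hg] at h1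
    have hz : (step q f C k s s' b st).z = (2 * q.θ₁ k / (2 * q.θ₁ k + q.η k * μ)) • st.z
        + (1 - 2 * q.θ₁ k / (2 * q.θ₁ k + q.η k * μ)) • x
        - (q.η k / (2 * q.θ₁ k + q.η k * μ)) • (st.h + (1 / (n : ℝ)) • ∑ i, C i (v i) s) := by
      simp only [step]
      rw [← hq.β_eq, ← hq.γ_eq, ← hx, sub_sub_cancel_left, smul_neg, smul_smul,
        div_mul_cancel₀ _ hη, ← sub_eq_add_neg]
    rw [hz]
    exact h1
  · rw [integral_add i1 i2, integral_add (integrable_const _) (hei.const_inner a),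
      integral_inner hei, he0, integral_const_mul]
    simp only [integral_const, probReal_univ, smul_eq_mul, one_mul, inner_zero_right, add_zero]
    have h3 := avg_error_at_query_le hL hμ hf st x
    have hη := hq.η_pos
    have h4 : q.η k / 2 * ∫ s, ‖e s‖ ^ 2 ∂ν
        ≤ q.η k / 2 * (ω / n * (4 * L * bregman f x st.w + 2 * shiftDist f st)) := by
      gcongr
      exact hvle.trans (by gcongr)
    linarith

/-- Expected progress of the local shifts. -/
lemma exists_bound_shift [IsProbabilityMeasure ν] (hC : IsIndepUnbiased ω ν C)
    (hL : 0 < L) (hμ : 0 ≤ μ) (hω : 0 ≤ ω) (hf : ∀ i, IsSmoothConvex L μ (f i))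
    {q : Params} {k : ℕ} (hq : q.Admissible L μ ω k) (st : State d n) (x : Vec d) :
    ∃ Q : S → ℝ, Integrable Q ν ∧
      (∀ s s', q.p * shiftDist f (step q f C k s s' true st)
        + (1 - q.p) * shiftDist f (step q f C k s s' false st) ≤ Q s') ∧
      ∫ s, Q s ∂ν ≤ (1 - q.α / 2) * shiftDist f st
        + 12 * q.p * L * (bregman f x st.w + bregman f x st.y) := by
  have hp0 := hq.p_nonneg
  have hα : q.α = 1 / (1 + ω) := hq.α_eq
  have hpα : q.p ≤ q.α := hα ▸ hq.p_le
  have hα1 : q.α ≤ 1 := by rw [hα, div_le_one (by linarith)]; linarith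
  have hsc : ∀ i, _ := fun i => hC.shift_contraction hω i (st.hloc i) (gradient (f i) st.w)
  simp only [← hα] at hsc
  set X : S → ℝ := fun s => (1 / (n : ℝ)) * ∑ i, ‖st.hloc i
      + q.α • C i (gradient (f i) st.w - st.hloc i) s - gradient (f i) st.w‖ ^ 2 with hX
  have hXi : Integrable X ν := (integrable_finsetSum _ fun i _ => (hsc i).1).const_mul _
  have hXle : ∫ s, X s ∂ν ≤ (1 - q.α) * shiftDist f st := by
    rw [hX, integral_const_mul, integral_finsetSum _ fun i _ => (hsc i).1, shiftDist,
      mul_left_comm, Finset.mul_sum _ _ (1 - q.α)]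
    gcongr with i
    exact (hsc i).2
  set E : ℝ := (1 / (n : ℝ)) * ∑ i, ‖gradient (f i) st.w - gradient (f i) st.y‖ ^ 2 with hE
  have hEle : E ≤ _ := avg_gradient_diff_le hL hμ hf x st.w st.y
  have hH : 0 ≤ shiftDist f st := by unfold shiftDist; positivity
  -- If `w` stays, the error is `X`; if it moves to `y`, Young's inequality gives at most `3/2 X +
  -- 3E`. The coin average has coefficient `(1 - p) + 3p/2 = 1 + p/2`.
  refine ⟨fun s => (1 + q.p / 2) * X s + q.p * (3 * E),
    (hXi.const_mul _).add (integrable_const _), ?_, ?_⟩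
  · intro s s'
    have hfalse : shiftDist f (step q f C k s s' false st) = X s' := by
      simp [shiftDist, step, hX]
    have htrue : shiftDist f (step q f C k s s' true st) ≤ 3 / 2 * X s' + 3 * E := by
      have h1 : shiftDist f (step q f C k s s' true st) ≤ (1 / (n : ℝ)) * ∑ i,
          (3 / 2 * ‖st.hloc i + q.α • C i (gradient (f i) st.w - st.hloc i) s'
              - gradient (f i) st.w‖ ^ 2
            + 3 * ‖gradient (f i) st.w - gradient (f i) st.y‖ ^ 2) := by
        simp only [shiftDist, step, if_true]
        gcongr with i
        refine le_trans (le_of_eq ?_) (norm_add_sq_le_three_halves _ _)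
        congr 2
        abel
      rw [Finset.sum_add_distrib, ← Finset.mul_sum, ← Finset.mul_sum] at h1
      rw [hX, hE]
      linarith
    rw [hfalse]
    have := mul_le_mul_of_nonneg_left htrue hp0
    linarith
  · rw [integral_add (hXi.const_mul _) (integrable_const _), integral_const_mul]
    simp only [integral_const, probReal_univ, smul_eq_mul, one_mul]
    have h1 : (1 + q.p / 2) * ∫ s, X s ∂ν ≤ (1 + q.p / 2) * ((1 - q.α) * shiftDist f st) := by
      gcongr
    -- The reason for `p ≤ α`: moving `w` may use up only half of the contraction.
    have h2 : (1 + q.p / 2) * (1 - q.α) ≤ 1 - q.α / 2 := by nlinarith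
    have h3 := mul_le_mul_of_nonneg_right h2 hH
    have h4 := mul_le_mul_of_nonneg_left hEle hp0
    linarith

end Expectation

/-! ### Structure of the iterates -/

section Iterate

variable {d n : ℕ} {f : Fin n → Vec d → ℝ} {S : Type*} {C : Fin n → Vec d → S → Vec d}

lemma iterate_congr (q : Params) (x0 : Vec d) (h0 : Fin n → Vec d) {ξ ξ' η η' : ℕ → S}
    {b c : ℕ → Bool} (T : ℕ) (h : ∀ k < T, (ξ k, ξ' k, b k) = (η k, η' k, c k)) :
    iterate q f C x0 h0 ξ ξ' b T = iterate q f C x0 h0 η η' c T := by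
  induction T with
  | zero => rfl
  | succ T ih =>
    have h1 := h T (Nat.lt_succ_self T)
    simp only [Prod.mk.injEq] at h1
    simp only [iterate, h1.1, h1.2.1, h1.2.2, ih fun k hk => h k (Nat.lt_succ_of_lt hk)]

lemma iterate_h_eq (q : Params) (x0 : Vec d) (h0 : Fin n → Vec d) (ξ ξ' : ℕ → S) (b : ℕ → Bool)
    (T : ℕ) : (iterate q f C x0 h0 ξ ξ' b T).h
      = (1 / (n : ℝ)) • ∑ i, (iterate q f C x0 h0 ξ ξ' b T).hloc i := by
  induction T with
  | zero => rfl
  | succ T ih =>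
    simp only [iterate, step]
    rw [ih, Finset.sum_add_distrib, smul_add, ← Finset.smul_sum, smul_smul, mul_comm q.α]

/-- Before the first iteration the output is the starting point. -/
lemma isAccurate_zero {Ω : Type*} [MeasurableSpace Ω] {P : Measure Ω} [IsProbabilityMeasure P]
    {q : Params} {x0 xstar : Vec d} {h0 : Fin n → Vec d} {ξ ξ' : ℕ → Ω → S} {b : ℕ → Ω → Bool}
    {ε : ℝ} (h : objective f x0 - objective f xstar ≤ ε) :
    IsAccurate P q f C x0 h0 ξ ξ' b xstar ε 0 := by
  have : ∀ st : State d n, st.w = x0 → st.y = x0 → output f st = x0 := by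
    intro st hw hy
    simp [output, hw, hy]
  simp only [IsAccurate, iterate, this]
  exact ⟨integrable_const _, by simpa using h⟩

end Iterate

/-! ### From one iteration to the whole run -/

section Chain

variable {d n : ℕ} {L μ ω : ℝ} {f : Fin n → Vec d → ℝ} {S : Type*} [MeasurableSpace S]
  {ν : Measure S} {C : Fin n → Vec d → S → Vec d}

/-- The state as a tuple of vectors. -/
def State.toTuple (st : State d n) : Vec d × Vec d × Vec d × Vec d × (Fin n → Vec d) :=
  (st.w, st.y, st.z, st.h, st.hloc)

instance State.instMeasurableSpace : MeasurableSpace (State d n) :=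
  MeasurableSpace.comap State.toTuple inferInstance

lemma State.measurable_toTuple : Measurable (State.toTuple (d := d) (n := n)) :=
  comap_measurable _

lemma State.measurable_w : Measurable (State.w (d := d) (n := n)) :=
  measurable_fst.comp State.measurable_toTuple

lemma State.measurable_y : Measurable (State.y (d := d) (n := n)) :=
  (measurable_fst.comp measurable_snd).comp State.measurable_toTuple

lemma State.measurable_z : Measurable (State.z (d := d) (n := n)) :=
  (measurable_fst.comp (measurable_snd.comp measurable_snd)).comp State.measurable_toTuple

lemma State.measurable_h : Measurable (State.h (d := d) (n := n)) :=
  (measurable_fst.comp (measurable_snd.comp (measurable_snd.comp measurable_snd))).comp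
    State.measurable_toTuple

lemma State.measurable_hloc (i : Fin n) : Measurable fun st : State d n => st.hloc i :=
  (measurable_pi_apply i).comp
    ((measurable_snd.comp (measurable_snd.comp (measurable_snd.comp measurable_snd))).comp
      State.measurable_toTuple)

lemma State.measurable_of_components {α : Type*} [MeasurableSpace α] {F : α → State d n}
    (hw : Measurable fun a => (F a).w) (hy : Measurable fun a => (F a).y)
    (hz : Measurable fun a => (F a).z) (hh : Measurable fun a => (F a).h)
    (hl : ∀ i, Measurable fun a => (F a).hloc i) : Measurable F :=
  measurable_comap_iff.2 (hw.prodMk (hy.prodMk (hz.prodMk (hh.prodMk (measurable_pi_lambda _ hl)))))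

lemma measurable_step (hC : ∀ i, Measurable (Function.uncurry (C i)))
    (hg : ∀ i, Measurable (gradient (f i))) (q : Params) (k : ℕ) :
    Measurable fun t : State d n × (S × S × Bool) =>
      step q f C k t.2.1 t.2.2.1 t.2.2.2 t.1 := by
  have mw : Measurable fun t : State d n × (S × S × Bool) => t.1.w :=
    State.measurable_w.comp measurable_fst
  have my : Measurable fun t : State d n × (S × S × Bool) => t.1.y :=
    State.measurable_y.comp measurable_fst
  have mz : Measurable fun t : State d n × (S × S × Bool) => t.1.z :=
    State.measurable_z.comp measurable_fst
  have mh : Measurable fun t : State d n × (S × S × Bool) => t.1.h :=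
    State.measurable_h.comp measurable_fst
  have ml : ∀ i, Measurable fun t : State d n × (S × S × Bool) => t.1.hloc i := fun i =>
    (State.measurable_hloc i).comp measurable_fst
  have ms : Measurable fun t : State d n × (S × S × Bool) => t.2.1 :=
    measurable_fst.comp measurable_snd
  have ms' : Measurable fun t : State d n × (S × S × Bool) => t.2.2.1 :=
    measurable_fst.comp (measurable_snd.comp measurable_snd)
  have mb : Measurable fun t : State d n × (S × S × Bool) => t.2.2.2 :=
    measurable_snd.comp (measurable_snd.comp measurable_snd)
  have mx : Measurable fun t : State d n × (S × S × Bool) => queryPoint q k t.1 := by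
    simp only [queryPoint]
    exact ((mz.const_smul (q.θ₁ k)).add (mw.const_smul q.θ₂)).add
      (my.const_smul (1 - q.θ₁ k - q.θ₂))
  have mm : ∀ i, Measurable fun t : State d n × (S × S × Bool) =>
      C i (gradient (f i) (queryPoint q k t.1) - t.1.hloc i) t.2.1 := fun i =>
    (hC i).comp ((((hg i).comp mx).sub (ml i)).prodMk ms)
  have mc : ∀ i, Measurable fun t : State d n × (S × S × Bool) =>
      C i (gradient (f i) t.1.w - t.1.hloc i) t.2.2.1 := fun i =>
    (hC i).comp ((((hg i).comp mw).sub (ml i)).prodMk ms')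
  have mg : Measurable fun t : State d n × (S × S × Bool) => t.1.h + (1 / (n : ℝ)) •
      ∑ i, C i (gradient (f i) (queryPoint q k t.1) - t.1.hloc i) t.2.1 :=
    mh.add ((Finset.measurable_fun_sum _ fun i _ => mm i).const_smul (1 / (n : ℝ)))
  have myN := mx.sub (mg.const_smul (q.η k))
  have mw' : Measurable fun t : State d n × (S × S × Bool) =>
      if t.2.2.2 then t.1.y else t.1.w :=
    Measurable.ite (mb (measurableSet_singleton true)) my mw
  have mz' := ((mz.const_smul q.β).add (mx.const_smul (1 - q.β))).add
    ((myN.sub mx).const_smul (q.γ k / q.η k))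
  have mh' := mh.add ((Finset.measurable_fun_sum Finset.univ fun i _ => mc i).const_smul
    (q.α * (1 / (n : ℝ))))
  refine State.measurable_of_components ?_ ?_ ?_ ?_ fun i => ?_
  · simp only [step]
    exact mw'
  · simp only [step]
    exact myN
  · simp only [step]
    exact mz'
  · simp only [step]
    exact mh'
  · simp only [step]
    exact (ml i).add ((mc i).const_smul q.α)

lemma measurable_iterate (hC : ∀ i, Measurable (Function.uncurry (C i)))
    (hg : ∀ i, Measurable (gradient (f i))) (q : Params) (x0 : Vec d) (h0 : Fin n → Vec d)
    {α : Type*} [MeasurableSpace α] {ξ ξ' : ℕ → α → S} {b : ℕ → α → Bool}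
    (hm : ∀ k, Measurable fun a => (ξ k a, ξ' k a, b k a)) (T : ℕ) :
    Measurable fun a =>
      iterate q f C x0 h0 (fun k => ξ k a) (fun k => ξ' k a) (fun k => b k a) T := by
  induction T with
  | zero => exact measurable_const
  | succ T ih => exact (measurable_step hC hg q T).comp (ih.prodMk (hm T))

/-- The state after `T` iterations is a measurable function of the inputs with index below `T`,
which are jointly independent of input `T`. -/
lemma indepFun_iterate (hC : ∀ i, Measurable (Function.uncurry (C i)))
    (hg : ∀ i, Measurable (gradient (f i))) (q : Params) (x0 : Vec d) (h0 : Fin n → Vec d)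
    {Ω : Type*} [MeasurableSpace Ω] {P : Measure Ω} [IsProbabilityMeasure P]
    {p : ℝ} {ξ ξ' : ℕ → Ω → S} {b : ℕ → Ω → Bool} (hr : IsRandomness P ν p ξ ξ' b) (T : ℕ) :
    IndepFun (fun o => iterate q f C x0 h0 (fun k => ξ k o) (fun k => ξ' k o) (fun k => b k o) T)
      (fun o => (ξ T o, ξ' T o, b T o)) P := by
  obtain ⟨o₀⟩ : Nonempty Ω := P.nonempty_of_neZero
  -- An arbitrary filler for the inputs with index `≥ T`, which do not influence the state.
  let D : S × S × Bool := (ξ 0 o₀, ξ' 0 o₀, b 0 o₀)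
  let ext (k : ℕ) (v : Finset.range T → S × S × Bool) : S × S × Bool :=
    if hk : k ∈ Finset.range T then v ⟨k, hk⟩ else D
  have hext : ∀ k, Measurable (ext k) := by
    intro k
    by_cases hk : k ∈ Finset.range T
    · simpa only [ext, hk, dif_pos] using measurable_pi_apply _
    · simpa only [ext, hk, dif_neg, not_false_eq_true] using measurable_const
  have hdisj : Disjoint (Finset.range T) {T} := by simp
  have h1 := hr.indep.indepFun_finset (Finset.range T) {T} hdisj hr.measurable
  have hφ := measurable_iterate hC hg q x0 h0 (ξ := fun k v => (ext k v).1)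
    (ξ' := fun k v => (ext k v).2.1) (b := fun k v => (ext k v).2.2) hext T
  have h2 := h1.comp hφ
    (measurable_pi_apply (⟨T, Finset.mem_singleton_self T⟩ : ({T} : Finset ℕ)))
  refine h2.congr ?_ (Filter.EventuallyEq.refl _ _)
  refine Filter.Eventually.of_forall fun o => iterate_congr q x0 h0 T fun k hk => ?_
  simp [ext, hk]

/-- Tonelli for the product law. It replaces conditioning on the past: with `X` the state and `Y`
the fresh input, the inner integral freezes the state. -/
lemma lintegral_indepFun {Ω α β : Type*} [MeasurableSpace Ω] [MeasurableSpace α]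
    [MeasurableSpace β] {P : Measure Ω} [IsProbabilityMeasure P] {X : Ω → α} {Y : Ω → β}
    (h : IndepFun X Y P) (hX : Measurable X) (hY : Measurable Y) {φ : α × β → ENNReal}
    (hφ : Measurable φ) :
    ∫⁻ o, φ (X o, Y o) ∂P = ∫⁻ o, ∫⁻ t, φ (X o, t) ∂(P.map Y) ∂P := by
  rw [← lintegral_map (g := fun o => (X o, Y o)) hφ (hX.prodMk hY),
    h.map_prod_eq_prod_map_map hX.aemeasurable hY.aemeasurable,
    lintegral_prod _ hφ.aemeasurable,
    lintegral_map hφ.lintegral_prod_right' hX]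

/-- The weights of a Lyapunov function: of `‖z - x⋆‖²`, of the suboptimality of `y` and of `w`,
and of the distance of the shifts. -/
structure Weights where
  z : ℝ
  y : ℝ
  w : ℝ
  h : ℝ

structure Weights.Nonneg (a : Weights) : Prop where
  z : 0 ≤ a.z
  y : 0 ≤ a.y
  w : 0 ≤ a.w
  h : 0 ≤ a.h

/-- The Lyapunov function with given weights. -/
def lyapunov (f : Fin n → Vec d → ℝ) (xstar : Vec d) (a : Weights) (st : State d n) : ℝ :=
  a.z * ‖st.z - xstar‖ ^ 2 + a.y * (objective f st.y - objective f xstar)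
    + a.w * (objective f st.w - objective f xstar) + a.h * shiftDist f st

lemma shiftDist_nonneg (st : State d n) : 0 ≤ shiftDist f st := by
  unfold shiftDist; positivity

lemma lyapunov_nonneg {xstar : Vec d} (hmin : ∀ x, objective f xstar ≤ objective f x)
    {a : Weights} (ha : a.Nonneg) (st : State d n) : 0 ≤ lyapunov f xstar a st := by
  have h1 := mul_nonneg ha.y (sub_nonneg.2 (hmin st.y))
  have h2 := mul_nonneg ha.w (sub_nonneg.2 (hmin st.w))
  have h3 := mul_nonneg ha.h (shiftDist_nonneg (f := f) st)
  have h4 := mul_nonneg ha.z (sq_nonneg ‖st.z - xstar‖)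
  unfold lyapunov
  linarith

lemma measurable_objective (hf : ∀ i, Differentiable ℝ (f i)) : Measurable (objective f) := by
  have : Continuous (objective f) :=
    continuous_const.mul (continuous_finsetSum _ fun i _ => (hf i).continuous)
  exact this.measurable

lemma measurable_lyapunov (hf : ∀ i, Differentiable ℝ (f i))
    (hg : ∀ i, Measurable (gradient (f i))) (xstar : Vec d) (a : Weights) :
    Measurable (lyapunov (n := n) f xstar a) := by
  have mo := measurable_objective hf
  have mH : Measurable (shiftDist (n := n) f) :=
    (Finset.measurable_fun_sum _ fun i _ => (((State.measurable_hloc i).sub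
      ((hg i).comp State.measurable_w)).norm.pow_const 2)).const_mul _
  exact (((((State.measurable_z.sub_const _).norm.pow_const 2).const_mul _).add
    (((mo.comp State.measurable_y).sub_const _).const_mul _)).add
    (((mo.comp State.measurable_w).sub_const _).const_mul _)).add (mH.const_mul _)

/-- The inequalities between the weights `a` before and `a'` after iteration `k` under which the
expected value of the Lyapunov function does not increase. -/
structure WeightsStep (q : Params) (n : ℕ) (L μ ω : ℝ) (k : ℕ) (a a' : Weights) : Prop where
  nonneg : a'.Nonneg
  z_eq : a'.z = a'.y * ((2 * q.θ₁ k + q.η k * μ) ^ 2 / (4 * q.η k))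
  z_le : a'.y * (q.θ₁ k * (2 * q.θ₁ k + q.η k * μ) / (2 * q.η k)) ≤ a.z
  y_le : a'.y * (1 - q.θ₁ k - q.θ₂) + a'.w * q.p ≤ a.y
  w_le : a'.y * q.θ₂ + a'.w * (1 - q.p) ≤ a.w
  h_le : a'.h * (1 - q.α / 2) + a'.y * (q.η k * (ω / n)) ≤ a.h
  bregman_w : a'.y * (q.η k * (ω / n)) * (2 * L) + 12 * q.p * L * a'.h ≤ a'.y * q.θ₂
  bregman_y : 12 * q.p * L * a'.h ≤ a'.y * (1 - q.θ₁ k - q.θ₂)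

/-- The bounds for `y`, `z` and for the shifts are added with the new weights. Each field of
`WeightsStep` controls the coefficient of one nonnegative quantity, and the two Bregman coefficients
become nonpositive. -/
lemma lintegral_lyapunov_step_le [IsProbabilityMeasure ν] (hC : IsIndepUnbiased ω ν C)
    (hn : 1 ≤ n) (hL : 0 < L) (hμ : 0 ≤ μ) (hω : 0 ≤ ω) (hf : ∀ i, IsSmoothConvex L μ (f i))
    {xstar : Vec d} (hmin : ∀ x, objective f xstar ≤ objective f x) {q : Params} {k : ℕ}
    (hq : q.Admissible L μ ω k) {a a' : Weights} (haa : WeightsStep q n L μ ω k a a')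
    (st : State d n) (hst : st.h = (1 / (n : ℝ)) • ∑ i, st.hloc i) :
    ∫⁻ t, ENNReal.ofReal (lyapunov f xstar a' (step q f C k t.1 t.2.1 t.2.2 st))
        ∂(ν.prod (ν.prod (coinLaw q.p))) ≤ ENNReal.ofReal (lyapunov f xstar a st) := by
  obtain ⟨Q, hQi, hQ, hQle⟩ := exists_bound_yz hC hn hL hμ hω hf hmin hq st hst
  obtain ⟨R, hRi, hR, hRle⟩ := exists_bound_shift hC hL hμ hω hf hq st (queryPoint q k st)
  have hp0 := hq.p_nonneg
  have hp1 : q.p ≤ 1 := hq.p_le.trans (by rw [div_le_one (by linarith)]; linarith)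
  set x := queryPoint q k st with hx
  set W : ℝ := a'.w * (q.p * (objective f st.y - objective f xstar)
    + (1 - q.p) * (objective f st.w - objective f xstar)) with hW
  have hFy := sub_nonneg.2 (hmin st.y)
  have hFw := sub_nonneg.2 (hmin st.w)
  have hW0 : 0 ≤ W := mul_nonneg haa.nonneg.w
    (add_nonneg (mul_nonneg hp0 hFy) (mul_nonneg (by linarith) hFw))
  have hQ0 : ∀ s, 0 ≤ Q s := by
    intro s
    refine le_trans ?_ (hQ s s true)
    have hη := hq.η_pos
    exact add_nonneg (by positivity) (sub_nonneg.2 (hmin _))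
  have hR0 : ∀ s, 0 ≤ R s := by
    intro s
    refine le_trans ?_ (hR s s)
    exact add_nonneg (mul_nonneg hp0 (shiftDist_nonneg _))
      (mul_nonneg (by linarith) (shiftDist_nonneg _))
  -- After averaging over the coin the bound separates into a function of `s` and one of `s'`.
  have hcoin : ∀ s s', ∫⁻ b, ENNReal.ofReal (lyapunov f xstar a' (step q f C k s s' b st))
      ∂(coinLaw q.p) ≤ ENNReal.ofReal (a'.y * Q s + W) + ENNReal.ofReal (a'.h * R s') := by
    intro s s'
    rw [lintegral_coinLaw, ← ENNReal.ofReal_mul hp0, ← ENNReal.ofReal_mul (by linarith),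
      ← ENNReal.ofReal_add
        (mul_nonneg hp0 (lyapunov_nonneg hmin haa.nonneg _))
        (mul_nonneg (by linarith) (lyapunov_nonneg hmin haa.nonneg _)),
      ← ENNReal.ofReal_add (add_nonneg (mul_nonneg haa.nonneg.y (hQ0 s)) hW0)
        (mul_nonneg haa.nonneg.h (hR0 s'))]
    apply ENNReal.ofReal_le_ofReal
    have hb : ∀ b, lyapunov f xstar a' (step q f C k s s' b st) ≤ a'.y * Q s
        + a'.w * (objective f (if b then st.y else st.w) - objective f xstar)
        + a'.h * shiftDist f (step q f C k s s' b st) := by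
      intro b
      have h1 := mul_le_mul_of_nonneg_left (hQ s s' b) haa.nonneg.y
      have h2 : (step q f C k s s' b st).w = if b then st.y else st.w := rfl
      unfold lyapunov
      rw [haa.z_eq, h2]
      linarith
    have ht := mul_le_mul_of_nonneg_left (hb true) hp0
    have hf' := mul_le_mul_of_nonneg_left (hb false) (by linarith : 0 ≤ 1 - q.p)
    have hR' := mul_le_mul_of_nonneg_left (hR s s') haa.nonneg.h
    simp only [if_true, Bool.false_eq_true, if_false] at ht hf'
    rw [hW]
    linarith
  have hQW : Integrable (fun s => a'.y * Q s + W) ν := (hQi.const_mul _).add (integrable_const _)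
  have hQWn : ∀ s, 0 ≤ a'.y * Q s + W := fun s =>
    add_nonneg (mul_nonneg haa.nonneg.y (hQ0 s)) hW0
  have hRn : ∀ s, 0 ≤ a'.h * R s := fun s => mul_nonneg haa.nonneg.h (hR0 s)
  calc ∫⁻ t, ENNReal.ofReal (lyapunov f xstar a' (step q f C k t.1 t.2.1 t.2.2 st))
        ∂(ν.prod (ν.prod (coinLaw q.p)))
      ≤ ∫⁻ s, ∫⁻ t, ENNReal.ofReal (lyapunov f xstar a' (step q f C k s t.1 t.2 st))
          ∂(ν.prod (coinLaw q.p)) ∂ν := lintegral_prod_le _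
    _ ≤ ∫⁻ s, ∫⁻ s', ∫⁻ b, ENNReal.ofReal (lyapunov f xstar a' (step q f C k s s' b st))
          ∂(coinLaw q.p) ∂ν ∂ν := lintegral_mono fun s => lintegral_prod_le _
    _ ≤ ∫⁻ s, ∫⁻ s', (ENNReal.ofReal (a'.y * Q s + W) + ENNReal.ofReal (a'.h * R s')) ∂ν ∂ν :=
        lintegral_mono fun s => lintegral_mono fun s' => hcoin s s'
    _ = ENNReal.ofReal (∫ s, (a'.y * Q s + W) ∂ν) + ENNReal.ofReal (∫ s, a'.h * R s ∂ν) := by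
        rw [ofReal_integral_eq_lintegral_ofReal hQW (Filter.Eventually.of_forall hQWn),
          ofReal_integral_eq_lintegral_ofReal (hRi.const_mul _) (Filter.Eventually.of_forall hRn)]
        simp only [lintegral_add_left measurable_const, lintegral_const, measure_univ, mul_one]
        rw [lintegral_add_right _ measurable_const]
        simp
    _ ≤ ENNReal.ofReal (lyapunov f xstar a st) := by
        rw [← ENNReal.ofReal_add (integral_nonneg hQWn) (integral_nonneg hRn)]
        apply ENNReal.ofReal_le_ofReal
        rw [integral_add (hQi.const_mul _) (integrable_const _), integral_const_mul a'.y,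
          integral_const_mul a'.h]
        simp only [integral_const, probReal_univ, smul_eq_mul, one_mul]
        have h1 := mul_le_mul_of_nonneg_left hQle haa.nonneg.y
        have h2 := mul_le_mul_of_nonneg_left hRle haa.nonneg.h
        have h3 := mul_le_mul_of_nonneg_right haa.z_le (sq_nonneg ‖st.z - xstar‖)
        have h4 := mul_le_mul_of_nonneg_right haa.y_le hFy
        have h5 := mul_le_mul_of_nonneg_right haa.w_le hFw
        have h6 := mul_le_mul_of_nonneg_right haa.h_le (shiftDist_nonneg (f := f) st)
        have h7 := mul_le_mul_of_nonneg_right haa.bregman_w (bregman_nonneg hn hμ hf x st.w)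
        have h8 := mul_le_mul_of_nonneg_right haa.bregman_y (bregman_nonneg hn hμ hf x st.y)
        unfold lyapunov
        linarith

lemma lintegral_lyapunov_iterate_le [IsProbabilityMeasure ν] (hC : IsIndepUnbiased ω ν C)
    (hn : 1 ≤ n) (hL : 0 < L) (hμ : 0 ≤ μ) (hω : 0 ≤ ω) (hf : ∀ i, IsSmoothConvex L μ (f i))
    {xstar : Vec d} (hmin : ∀ x, objective f xstar ≤ objective f x) {q : Params}
    (hq : ∀ k, q.Admissible L μ ω k) {a : ℕ → Weights}
    (ha : ∀ k, WeightsStep q n L μ ω k (a k) (a (k + 1)))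
    (x0 : Vec d) (h0 : Fin n → Vec d)
    {Ω : Type*} [MeasurableSpace Ω] {P : Measure Ω} [IsProbabilityMeasure P]
    {ξ ξ' : ℕ → Ω → S} {b : ℕ → Ω → Bool} (hr : IsRandomness P ν q.p ξ ξ' b) (T : ℕ) :
    ∫⁻ o, ENNReal.ofReal (lyapunov f xstar (a T)
        (iterate q f C x0 h0 (fun k => ξ k o) (fun k => ξ' k o) (fun k => b k o) T)) ∂P
      ≤ ENNReal.ofReal (lyapunov f xstar (a 0)
          ⟨x0, x0, x0, (1 / (n : ℝ)) • ∑ i, h0 i, h0⟩) := by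
  have hg : ∀ i, Measurable (gradient (f i)) := fun i =>
    ((hf i).continuous_gradient hL hμ).measurable
  induction T with
  | zero => simp [iterate]
  | succ T ih =>
    refine le_trans ?_ ih
    have hm := measurable_iterate hC.measurable hg q x0 h0 hr.measurable T
    have hφ : Measurable fun t : State d n × (S × S × Bool) => ENNReal.ofReal
        (lyapunov f xstar (a (T + 1)) (step q f C T t.2.1 t.2.2.1 t.2.2.2 t.1)) :=
      ((measurable_lyapunov (fun i => (hf i).differentiable) hg xstar (a (T + 1))).comp
        (measurable_step hC.measurable hg q T)).ennreal_ofReal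
    have h1 := lintegral_indepFun (indepFun_iterate hC.measurable hg q x0 h0 hr T) hm
      (hr.measurable T) hφ
    rw [hr.law T] at h1
    refine h1.le.trans (lintegral_mono fun o => ?_)
    exact lintegral_lyapunov_step_le hC hn hL hμ hω hf hmin (hq T) (ha T) _
      (iterate_h_eq q x0 h0 _ _ _ T)

/-- The gap of the output is the smaller of the gaps at `w` and `y`, hence at most the Lyapunov
function divided by the sum of their weights. Finiteness of the lower integral also gives
integrability. -/
lemma isAccurate_of_weights [IsProbabilityMeasure ν] (hC : IsIndepUnbiased ω ν C)
    (hn : 1 ≤ n) (hL : 0 < L) (hμ : 0 ≤ μ) (hω : 0 ≤ ω) (hf : ∀ i, IsSmoothConvex L μ (f i))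
    {xstar : Vec d} (hmin : ∀ x, objective f xstar ≤ objective f x) {q : Params}
    (hq : ∀ k, q.Admissible L μ ω k) {a : ℕ → Weights} (ha0 : (a 0).Nonneg)
    (ha : ∀ k, WeightsStep q n L μ ω k (a k) (a (k + 1)))
    (x0 : Vec d) (h0 : Fin n → Vec d)
    {Ω : Type*} [MeasurableSpace Ω] {P : Measure Ω} [IsProbabilityMeasure P]
    {ξ ξ' : ℕ → Ω → S} {b : ℕ → Ω → Bool} (hr : IsRandomness P ν q.p ξ ξ' b) (T : ℕ)
    (hpos : 0 < (a T).y + (a T).w) {ε : ℝ}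
    (hε : lyapunov f xstar (a 0) ⟨x0, x0, x0, (1 / (n : ℝ)) • ∑ i, h0 i, h0⟩
      ≤ ((a T).y + (a T).w) * ε) :
    IsAccurate P q f C x0 h0 ξ ξ' b xstar ε T := by
  have hg : ∀ i, Measurable (gradient (f i)) := fun i =>
    ((hf i).continuous_gradient hL hμ).measurable
  have mo := measurable_objective fun i => (hf i).differentiable
  have hm := measurable_iterate hC.measurable hg q x0 h0 hr.measurable T
  have haT : (a T).Nonneg := by
    cases T with
    | zero => exact ha0
    | succ T => exact (ha T).nonneg
  set st : Ω → State d n := fun o =>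
    iterate q f C x0 h0 (fun k => ξ k o) (fun k => ξ' k o) (fun k => b k o) T with hst
  have hmin_eq : ∀ o, objective f (output f (st o))
      = min (objective f (st o).w) (objective f (st o).y) := by
    intro o
    unfold output
    split_ifs with h
    · rw [min_eq_left h]
    · rw [min_eq_right (le_of_not_ge h)]
  have hmeas : Measurable fun o => objective f (output f (st o)) := by
    simp only [hmin_eq]
    exact (mo.comp (State.measurable_w.comp hm)).min (mo.comp (State.measurable_y.comp hm))
  set F : Ω → ℝ := fun o => objective f (output f (st o)) - objective f xstar with hF
  have hF0 : ∀ o, 0 ≤ F o := fun o => sub_nonneg.2 (hmin _)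
  have hFm : Measurable F := hmeas.sub_const _
  set V := lyapunov f xstar (a 0) ⟨x0, x0, x0, (1 / (n : ℝ)) • ∑ i, h0 i, h0⟩ with hV
  have hV0 : 0 ≤ V := lyapunov_nonneg hmin ha0 _
  have hle : ∀ o, F o ≤ 1 / ((a T).y + (a T).w) * lyapunov f xstar (a T) (st o) := by
    intro o
    rw [div_mul_eq_mul_div, one_mul, le_div_iff₀ hpos]
    have e1 : F o ≤ objective f (st o).w - objective f xstar := by
      simp only [hF, hmin_eq]; linarith [min_le_left (objective f (st o).w) (objective f (st o).y)]
    have e2 : F o ≤ objective f (st o).y - objective f xstar := by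
      simp only [hF, hmin_eq]; linarith [min_le_right (objective f (st o).w) (objective f (st o).y)]
    have e3 := mul_le_mul_of_nonneg_left e1 haT.w
    have e4 := mul_le_mul_of_nonneg_left e2 haT.y
    have e5 := mul_nonneg haT.h (shiftDist_nonneg (f := f) (st o))
    have e6 := mul_nonneg haT.z (sq_nonneg ‖(st o).z - xstar‖)
    unfold lyapunov
    linarith
  have hc : 0 ≤ 1 / ((a T).y + (a T).w) := by positivity
  have hlin : ∫⁻ o, ENNReal.ofReal (F o) ∂P
      ≤ ENNReal.ofReal (1 / ((a T).y + (a T).w) * V) := by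
    calc ∫⁻ o, ENNReal.ofReal (F o) ∂P
        ≤ ∫⁻ o, ENNReal.ofReal (1 / ((a T).y + (a T).w))
            * ENNReal.ofReal (lyapunov f xstar (a T) (st o)) ∂P := by
          refine lintegral_mono fun o => ?_
          rw [← ENNReal.ofReal_mul hc]
          exact ENNReal.ofReal_le_ofReal (hle o)
      _ = ENNReal.ofReal (1 / ((a T).y + (a T).w))
            * ∫⁻ o, ENNReal.ofReal (lyapunov f xstar (a T) (st o)) ∂P :=
          lintegral_const_mul' _ _ ENNReal.ofReal_ne_top
      _ ≤ ENNReal.ofReal (1 / ((a T).y + (a T).w)) * ENNReal.ofReal V := by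
          gcongr
          exact lintegral_lyapunov_iterate_le hC hn hL hμ hω hf hmin hq ha x0 h0 hr T
      _ = _ := by rw [← ENNReal.ofReal_mul hc]
  have hFi : Integrable F P :=
    ⟨hFm.aestronglyMeasurable, (hasFiniteIntegral_iff_ofReal (Filter.Eventually.of_forall hF0)).2
      (hlin.trans_lt ENNReal.ofReal_lt_top)⟩
  have hoi : Integrable (fun o => objective f (output f (st o))) P := by
    refine (hFi.add (integrable_const (objective f xstar))).congr
      (Filter.Eventually.of_forall fun o => ?_)
    simp [hF]
  refine ⟨hoi, ?_⟩
  have h1 : ∫ o, F o ∂P = ∫ o, objective f (output f (st o)) ∂P - objective f xstar := by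
    rw [hF, integral_sub hoi (integrable_const _)]
    simp
  change ∫ o, objective f (output f (st o)) ∂P - objective f xstar ≤ ε
  rw [← h1, integral_eq_lintegral_of_nonneg_ae (Filter.Eventually.of_forall hF0)
    hFm.aestronglyMeasurable]
  refine (ENNReal.toReal_mono ENNReal.ofReal_ne_top hlin).trans ?_
  rw [ENNReal.toReal_ofReal (mul_nonneg hc hV0), div_mul_eq_mul_div, one_mul, div_le_iff₀ hpos]
  linarith

end Chain

/-! ### Weights in the generally convex case -/

section GenerallyConvex

variable {n : ℕ} {L ω : ℝ}

/-- The part of the minimum defining `ηₖ` that does not depend on `k`. -/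
lemma exists_gcη_eq_min (hn : 1 ≤ n) (hL : 0 < L) (hω : 0 ≤ ω) :
    ∃ R : ℝ, 0 < R ∧ R ≤ 1 / (2 * L) ∧ R * (ω / n) ≤ 3 / (200 * (1 + ω) * L) ∧
      3 / (200 * L * (1 + ω / √(n : ℝ)) ^ 2) ≤ R ∧
      ∀ k : ℕ, gcη n L ω k
        = min (((k : ℝ) + 1 + 27 * (1 + ω)) / (9 * (1 + ω) ^ 2 * (1 + 27 * (1 + ω)) * L)) R := by
  have hn0 : (1 : ℝ) ≤ n := by exact_mod_cast hn
  have hs1 : 1 ≤ √(n : ℝ) := Real.one_le_sqrt.2 hn0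
  have hss : √(n : ℝ) ^ 2 = n := Real.sq_sqrt (by linarith)
  have hlow : 3 / (200 * L * (1 + ω / √(n : ℝ)) ^ 2) ≤ 1 / (2 * L) := by
    have : 1 ≤ (1 + ω / √(n : ℝ)) ^ 2 := one_le_pow₀ (by
      have : 0 ≤ ω / √(n : ℝ) := by positivity
      linarith)
    rw [div_le_div_iff₀ (by positivity) (by positivity)]
    nlinarith
  rcases eq_or_ne ω 0 with h0 | h0
  · subst h0
    refine ⟨1 / (2 * L), by positivity, le_rfl, ?_, hlow, fun k => by simp [gcη]⟩
    simp only [zero_div, mul_zero]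
    positivity
  · have hωp : 0 < ω := lt_of_le_of_ne hω (Ne.symm h0)
    refine ⟨min (3 * n / (200 * ω * (1 + ω) * L)) (1 / (2 * L)), ?_, min_le_right _ _, ?_, ?_,
      fun k => by simp [gcη, h0]⟩
    · exact lt_min (by positivity) (by positivity)
    · calc min (3 * n / (200 * ω * (1 + ω) * L)) (1 / (2 * L)) * (ω / n)
          ≤ 3 * n / (200 * ω * (1 + ω) * L) * (ω / n) := by
            gcongr
            exact min_le_left _ _
        _ = 3 / (200 * (1 + ω) * L) := by field_simp
    · refine le_min ?_ hlow
      have h1 : (1 + ω / √(n : ℝ)) ^ 2 * n = (√(n : ℝ) + ω) ^ 2 := by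
        have h2 : 1 + ω / √(n : ℝ) = (√(n : ℝ) + ω) / √(n : ℝ) := by field_simp
        rw [h2, div_pow, hss]
        field_simp
      rw [div_le_div_iff₀ (by positivity) (by positivity)]
      -- The right side is `(√n + ω)²`, and `√n ≥ 1`.
      have h2 : ω * (1 + ω) ≤ (1 + ω / √(n : ℝ)) ^ 2 * n := by rw [h1]; nlinarith
      have h3 := mul_le_mul_of_nonneg_left h2 (by positivity : 0 ≤ 600 * L)
      linarith

lemma gcη_pos (hn : 1 ≤ n) (hL : 0 < L) (hω : 0 ≤ ω) (k : ℕ) : 0 < gcη n L ω k := by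
  obtain ⟨R, hR, -, -, -, h⟩ := exists_gcη_eq_min hn hL hω
  rw [h]
  exact lt_min (by positivity) hR

/-- Equality holds for the branch of the minimum that is linear in `k`; for the constant branch the
inequality is plain monotonicity. -/
lemma gcη_succ_mul_le (hn : 1 ≤ n) (hL : 0 < L) (hω : 0 ≤ ω) (k : ℕ) :
    gcη n L ω (k + 1) * (k + 1 + 27 * (1 + ω)) ≤ gcη n L ω k * (k + 2 + 27 * (1 + ω)) := by
  obtain ⟨R, hR, -, -, -, h⟩ := exists_gcη_eq_min hn hL hω
  rw [h, h, min_mul_of_nonneg _ _ (by positivity), min_mul_of_nonneg _ _ (by positivity)]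
  apply min_le_min
  · apply le_of_eq
    push_cast
    ring
  · gcongr
    linarith

/-- `ηₖ / θ₁ₖ²` in the generally convex case. -/
def gcLambda (n : ℕ) (L ω : ℝ) (k : ℕ) : ℝ := gcη n L ω k / gcθ₁ ω k ^ 2

lemma gcθ₁_pos (hω : 0 ≤ ω) (k : ℕ) : 0 < gcθ₁ ω k := by
  unfold gcθ₁; positivity

lemma gcLambda_pos (hn : 1 ≤ n) (hL : 0 < L) (hω : 0 ≤ ω) (k : ℕ) : 0 < gcLambda n L ω k :=
  div_pos (gcη_pos hn hL hω k) (pow_pos (gcθ₁_pos hω k) 2)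

lemma gcLambda_eq (hω : 0 ≤ ω) (k : ℕ) :
    gcLambda n L ω k = gcη n L ω k * (k + 27 * (1 + ω)) ^ 2 / 81 := by
  have : (k : ℝ) + 27 * (1 + ω) ≠ 0 := by positivity
  unfold gcLambda gcθ₁
  field_simp
  norm_num

lemma gcLambda_zero_mul_le (hn : 1 ≤ n) (hL : 0 < L) (hω : 0 ≤ ω) : gcLambda n L ω 0 * L ≤ 1 := by
  obtain ⟨R, hR, -, -, -, h⟩ := exists_gcη_eq_min hn hL hω
  have h1 : gcη n L ω 0 ≤ 1 / (9 * (1 + ω) ^ 2 * L) := by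
    rw [h]
    refine (min_le_left _ _).trans (le_of_eq ?_)
    have : 1 + 27 * (1 + ω) ≠ 0 := by positivity
    push_cast
    rw [zero_add]
    field_simp
  rw [gcLambda_eq hω]
  calc gcη n L ω 0 * (((0 : ℕ) : ℝ) + 27 * (1 + ω)) ^ 2 / 81 * L
      ≤ 1 / (9 * (1 + ω) ^ 2 * L) * (((0 : ℕ) : ℝ) + 27 * (1 + ω)) ^ 2 / 81 * L := by gcongr
    _ = 1 := by push_cast; field_simp; ring

/-- The growth limit on the weights, from the ratio bound on `ηₖ` and `θ₁ₖ = 9/τ`. At `k = 0`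
truncated subtraction makes both weights equal and the claim is trivial. -/
lemma gcLambda_mul_le (hn : 1 ≤ n) (hL : 0 < L) (hω : 0 ≤ ω) (k : ℕ) {τ : ℝ}
    (hτ : τ = k + 27 * (1 + ω)) :
    gcLambda n L ω k * (τ - 1) ^ 2 ≤ gcLambda n L ω (k - 1) * (τ * (τ + 1)) := by
  have hτ1 : 1 ≤ τ := by
    have : (0 : ℝ) ≤ k := by positivity
    linarith
  cases k with
  | zero =>
    have := (gcLambda_pos hn hL hω 0).le
    gcongr
    nlinarith
  | succ k =>
    have h := gcη_succ_mul_le hn hL hω k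
    have h1 := mul_le_mul_of_nonneg_right h (by positivity : 0 ≤ τ * (τ - 1) ^ 2 / 81)
    simp only [Nat.add_sub_cancel]
    rw [gcLambda_eq hω, gcLambda_eq hω]
    push_cast at hτ ⊢
    have e1 : (k : ℝ) + 1 + 27 * (1 + ω) = τ := hτ.symm
    have e2 : (k : ℝ) + 2 + 27 * (1 + ω) = τ + 1 := by linarith
    have e3 : (k : ℝ) + 27 * (1 + ω) = τ - 1 := by linarith
    rw [e1, e2] at h1
    rw [e1, e3]
    linarith

lemma gcParams_admissible (hn : 1 ≤ n) (hL : 0 < L) (hω : 0 ≤ ω) (k : ℕ) :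
    (gcParams n L ω).Admissible L 0 ω k where
  θ₁_pos := gcθ₁_pos hω k
  η_pos := gcη_pos hn hL hω k
  η_mul_le := by
    obtain ⟨R, hR, hR1, -, -, h⟩ := exists_gcη_eq_min hn hL hω
    have h1 : gcη n L ω k ≤ 1 / (2 * L) := by
      rw [h]
      exact (min_le_right _ _).trans hR1
    have h2 := mul_le_mul_of_nonneg_right h1 hL.le
    have h3 : 1 / (2 * L) * L = 1 / 2 := by field_simp
    simpa only [gcParams, h3] using h2
  β_eq := by
    have := (gcθ₁_pos hω k).ne'
    simp [gcParams, this]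
  γ_eq := by simp [gcParams]
  α_eq := rfl
  p_nonneg := by simp only [gcParams]; positivity
  p_le := by
    simp only [gcParams]
    gcongr
    linarith

/-- The weights of the Lyapunov function in the generally convex case. -/
def gcWeights (n : ℕ) (L ω : ℝ) (k : ℕ) : Weights where
  z := 1
  y := gcLambda n L ω (k - 1)
  w := gcLambda n L ω (k - 1) * (1 + 15 * (1 + ω) / (k + 27 * (1 + ω) - 1))
  h := gcLambda n L ω (k - 1) / (20 * L)

lemma gcWeights_nonneg (hn : 1 ≤ n) (hL : 0 < L) (hω : 0 ≤ ω) (k : ℕ) :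
    (gcWeights n L ω k).Nonneg := by
  have h1 := gcLambda_pos hn hL hω (k - 1)
  have h2 : 0 < (k : ℝ) + 27 * (1 + ω) - 1 := by
    have : (0 : ℝ) ≤ k := by positivity
    linarith
  constructor <;> simp only [gcWeights] <;> positivity

lemma gcWeights_step (hn : 1 ≤ n) (hL : 0 < L) (hω : 0 ≤ ω) (k : ℕ) :
    WeightsStep (gcParams n L ω) n L 0 ω k (gcWeights n L ω k) (gcWeights n L ω (k + 1)) := by
  have hη := gcη_pos hn hL hω k
  have hθ := gcθ₁_pos hω k
  have hl := gcLambda_pos hn hL hω k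
  obtain ⟨R, hR, -, hR2, -, hmin⟩ := exists_gcη_eq_min hn hL hω
  have hηω : gcη n L ω k * (ω / n) ≤ 3 / (200 * (1 + ω) * L) := by
    refine le_trans ?_ hR2
    rw [hmin]
    gcongr
    exact min_le_right _ _
  have hlη := mul_le_mul_of_nonneg_left hηω hl.le
  obtain ⟨τ, hτ⟩ : ∃ τ : ℝ, τ = k + 27 * (1 + ω) := ⟨_, rfl⟩
  have hτ27 : 27 * (1 + ω) ≤ τ := by
    have : (0 : ℝ) ≤ k := by positivity
    linarith
  have hτ0 : 0 < τ := by linarith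
  have hτ1 : 0 < τ - 1 := by linarith
  have hω1 : 0 < 1 + ω := by linarith
  have hθτ : gcθ₁ ω k = 9 / τ := by rw [hτ]; rfl
  have hratio := gcLambda_mul_le hn hL hω k hτ
  -- By the growth limit, comparing weighted coefficients reduces to a polynomial inequality in `τ`.
  have key : ∀ c c' : ℝ, 0 ≤ c → c * (τ * (τ + 1)) ≤ c' * (τ - 1) ^ 2 →
      gcLambda n L ω k * c ≤ gcLambda n L ω (k - 1) * c' := by
    intro c c' hc h
    have h1 := mul_le_mul_of_nonneg_left hratio hc
    have h2 := mul_le_mul_of_nonneg_left h (gcLambda_pos hn hL hω (k - 1)).le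
    refine le_of_mul_le_mul_right ?_ (pow_pos hτ1 2)
    linarith
  have hwn : (gcWeights n L ω (k + 1)).w = gcLambda n L ω k * (1 + 15 * (1 + ω) / τ) := by
    simp only [gcWeights, Nat.add_sub_cancel]
    rw [hτ]
    push_cast
    ring_nf
  have hyn : (gcWeights n L ω (k + 1)).y = gcLambda n L ω k := rfl
  have hhn : (gcWeights n L ω (k + 1)).h = gcLambda n L ω k / (20 * L) := rfl
  have hw : (gcWeights n L ω k).w
      = gcLambda n L ω (k - 1) * (1 + 15 * (1 + ω) / (τ - 1)) := by rw [hτ]; rfl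
  refine ⟨gcWeights_nonneg hn hL hω (k + 1), ?_, ?_, ?_, ?_, ?_, ?_, ?_⟩
  · rw [hyn]
    simp only [gcWeights, gcParams, gcLambda, mul_zero, add_zero]
    field_simp
    norm_num
  · rw [hyn]
    simp only [gcWeights, gcParams, gcLambda, mul_zero, add_zero]
    apply le_of_eq
    field_simp
  · rw [hyn, hwn]
    simp only [gcWeights, gcParams, hθτ]
    -- Here `θ₁ = 9/τ` is lost, `θ₂ = p` cancels, and the extra weight of `w` returns `15(1+ω)/τ · p
    -- = 5/τ`. The same `5/τ` is the decrease available to `w` below.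
    have h1 := key (1 - 4 / τ) 1 (by rw [sub_nonneg, div_le_one hτ0]; linarith) (by
      have : (1 - 4 / τ) * (τ * (τ + 1)) = (τ - 4) * (τ + 1) := by field_simp
      rw [this]; nlinarith)
    rw [mul_one] at h1
    refine le_trans (le_of_eq ?_) h1
    field_simp
    ring
  · rw [hyn, hwn, hw]
    simp only [gcParams]
    have h1 := key (1 + 15 * (1 + ω) / τ - 5 / τ) (1 + 15 * (1 + ω) / (τ - 1)) (by
      rw [add_sub_assoc, ← sub_div]
      have : 0 ≤ 15 * (1 + ω) - 5 := by linarith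
      positivity) (by
      have e1 : (1 + 15 * (1 + ω) / τ - 5 / τ) * (τ * (τ + 1))
          = (τ + 15 * (1 + ω) - 5) * (τ + 1) := by field_simp
      have e2 : (1 + 15 * (1 + ω) / (τ - 1)) * (τ - 1) ^ 2
          = (τ - 1) ^ 2 + 15 * (1 + ω) * (τ - 1) := by field_simp
      rw [e1, e2]; nlinarith)
    refine le_trans (le_of_eq ?_) h1
    field_simp
    ring
  · rw [hyn, hhn]
    have e0 : (gcWeights n L ω k).h = gcLambda n L ω (k - 1) * (1 / (20 * L)) := by
      simp only [gcWeights]; ring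
    rw [e0]
    simp only [gcParams]
    -- In units of `1/(1+ω)`, the contraction `1/2` minus the noise `3/10` leaves `1/5`. The offset
    -- `27(1+ω)` in `τ` makes this exceed the growth of the weights.
    have h1 := key ((1 - 1 / (5 * (1 + ω))) * (1 / (20 * L))) (1 / (20 * L)) (by
      have : 0 ≤ 1 - 1 / (5 * (1 + ω)) := by
        rw [sub_nonneg, div_le_one (by positivity)]; linarith
      positivity) (by
      have e1 : (1 - 1 / (5 * (1 + ω))) * (1 / (20 * L)) * (τ * (τ + 1))
          = ((τ * (τ + 1)) - τ / (5 * (1 + ω)) * (τ + 1)) * (1 / (20 * L)) := by ring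
      rw [e1, mul_comm (1 / (20 * L))]
      gcongr
      have h5 : 27 / 5 ≤ τ / (5 * (1 + ω)) := by
        rw [div_le_div_iff₀ (by positivity) (by positivity)]; linarith
      nlinarith)
    refine le_trans ?_ h1
    have e2 : gcLambda n L ω k * (3 / (200 * (1 + ω) * L))
        = gcLambda n L ω k * (3 / (10 * (1 + ω))) * (1 / (20 * L)) := by field_simp; norm_num
    rw [e2] at hlη
    refine (add_le_add_right hlη _).trans (le_of_eq ?_)
    field_simp
    ring
  · rw [hyn, hhn]
    simp only [gcParams]
    have h1 := mul_le_mul_of_nonneg_right hlη (by positivity : 0 ≤ 2 * L)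
    have e1 : gcLambda n L ω k * (3 / (200 * (1 + ω) * L)) * (2 * L)
        = gcLambda n L ω k * (1 / (3 * (1 + ω))) * (9 / 100) := by field_simp; norm_num
    have e2 : 12 * (1 / (3 * (1 + ω))) * L * (gcLambda n L ω k / (20 * L))
        = gcLambda n L ω k * (1 / (3 * (1 + ω))) * (3 / 5) := by field_simp; norm_num
    rw [e1] at h1
    rw [e2]
    have h3 : 0 ≤ gcLambda n L ω k * (1 / (3 * (1 + ω))) := by positivity
    linarith
  · rw [hyn, hhn]
    simp only [gcParams, hθτ]
    have e2 : 12 * (1 / (3 * (1 + ω))) * L * (gcLambda n L ω k / (20 * L))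
        = gcLambda n L ω k * (1 / (3 * (1 + ω)) * (3 / 5)) := by field_simp; norm_num
    rw [e2]
    gcongr
    have h5 : 9 / τ ≤ 1 / 3 := by
      rw [div_le_div_iff₀ (by positivity) (by positivity)]; linarith
    have h6 : 1 / (3 * (1 + ω)) ≤ 1 / 3 := by gcongr; linarith
    linarith

lemma lyapunov_initial_le {d : ℕ} {f : Fin n → Vec d → ℝ} {μ Δ : ℝ} (hn : 1 ≤ n) (hL : 0 ≤ L)
    (hf : ∀ i, IsSmoothConvex L μ (f i)) {x0 xstar : Vec d} {h0 : Fin n → Vec d}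
    (hmin : ∀ x, objective f xstar ≤ objective f x) (hΔ : ‖x0 - xstar‖ ^ 2 ≤ Δ)
    (hh : (1 / (n : ℝ)) * ∑ i, ‖h0 i - gradient (f i) x0‖ ^ 2 ≤ L ^ 2 * Δ)
    {a : Weights} (ha : a.Nonneg) (v : Vec d) :
    lyapunov f xstar a ⟨x0, x0, x0, v, h0⟩
      ≤ (a.z + (a.y + a.w) * (L / 2) + a.h * L ^ 2) * Δ := by
  have h1 := objective_sub_minimizer_le hn hL hf hmin x0
  have h2 : L / 2 * ‖x0 - xstar‖ ^ 2 ≤ L / 2 * Δ := by gcongr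
  have h3 := mul_le_mul_of_nonneg_left (h1.trans h2) (add_nonneg ha.y ha.w)
  have h4 := mul_le_mul_of_nonneg_left hΔ ha.z
  have h5 := mul_le_mul_of_nonneg_left hh ha.h
  unfold lyapunov shiftDist
  dsimp only
  linarith

lemma gcWeights_initial_le {Δ : ℝ} (hn : 1 ≤ n) (hL : 0 < L) (hω : 0 ≤ ω) (hΔ : 0 ≤ Δ) :
    ((gcWeights n L ω 0).z + ((gcWeights n L ω 0).y + (gcWeights n L ω 0).w) * (L / 2)
      + (gcWeights n L ω 0).h * L ^ 2) * Δ ≤ 3 * Δ := by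
  gcongr
  simp only [gcWeights, Nat.cast_zero, zero_add, Nat.zero_sub]
  have h1 := gcLambda_zero_mul_le hn hL hω
  have h2 : 15 * (1 + ω) / (27 * (1 + ω) - 1) ≤ 1 := by
    rw [div_le_one (by linarith)]; linarith
  have h3 : gcLambda n L ω 0 / (20 * L) * L ^ 2 = gcLambda n L ω 0 * L / 20 := by field_simp
  have h4 := mul_le_mul_of_nonneg_left h2
    (mul_pos (gcLambda_pos hn hL hω 0) hL).le
  rw [h3]
  linarith

/-- The budget of the generally convex case makes the weights large enough. -/
lemma gcLambda_large {Δ ε : ℝ} (hn : 1 ≤ n) (hL : 0 < L) (hω : 0 ≤ ω) (hΔ : 0 ≤ Δ) (hε : 0 < ε)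
    {T : ℕ} (hT1 : 1 ≤ T) (hT : 90 * ((1 + ω) * (L * Δ / ε) ^ (1 / 3 : ℝ)
      + (1 + ω / √(n : ℝ)) * √(L * Δ / ε)) ≤ T) :
    3 * Δ ≤ 2 * gcLambda n L ω (T - 1) * ε := by
  set r := L * Δ / ε with hr
  have hr0 : 0 ≤ r := by positivity
  have hΔr : Δ = r * ε / L := by rw [hr]; field_simp
  have ha0 : 0 ≤ (1 + ω) * r ^ (1 / 3 : ℝ) := by positivity
  have hb0 : 0 ≤ (1 + ω / √(n : ℝ)) * √r := by positivity
  have hcube : (r ^ (1 / 3 : ℝ)) ^ 3 = r := by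
    rw [← Real.rpow_natCast, ← Real.rpow_mul hr0]; norm_num
  have hsq : √r ^ 2 = r := Real.sq_sqrt hr0
  have h3 : (90 * ((1 + ω) * r ^ (1 / 3 : ℝ))) ^ 3 ≤ (T : ℝ) ^ 3 := by
    gcongr
    linarith
  have h2 : (90 * ((1 + ω / √(n : ℝ)) * √r)) ^ 2 ≤ (T : ℝ) ^ 2 := by
    gcongr
    linarith
  rw [mul_pow, mul_pow, hcube] at h3
  rw [mul_pow, mul_pow, hsq] at h2
  obtain ⟨R, hR, -, -, hRlow, hmin⟩ := exists_gcη_eq_min hn hL hω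
  obtain ⟨m, rfl⟩ : ∃ m, T = m + 1 := ⟨T - 1, by omega⟩
  rw [Nat.add_sub_cancel, gcLambda_eq hω, hmin]
  set τ : ℝ := (m : ℝ) + 27 * (1 + ω) with hτ
  have hTτ : ((m + 1 : ℕ) : ℝ) ≤ τ := by push_cast; linarith
  have hT0 : (0 : ℝ) ≤ ((m + 1 : ℕ) : ℝ) := by positivity
  set t : ℝ := ((m + 1 : ℕ) : ℝ) with ht
  have hτ0 : 0 ≤ τ := hT0.trans hTτ
  -- `243/2 = 81 · 3/2`, with `81` from `θ₁ₖ²`. The factor `90` of the budget is exact for the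
  -- constant branch: `90² · 3/200 = 243/2`.
  suffices h : 243 / 2 * Δ ≤ min (((m : ℝ) + 1 + 27 * (1 + ω)) /
      (9 * (1 + ω) ^ 2 * (1 + 27 * (1 + ω)) * L)) R * τ ^ 2 * ε by linarith
  rw [min_mul_of_nonneg _ _ (by positivity), min_mul_of_nonneg _ _ hε.le]
  refine le_min ?_ ?_
  -- `252 = 9 · 28`, as `1 + 27(1+ω) ≤ 28(1+ω)`.
  · calc 243 / 2 * Δ = 243 / 2 * r * (ε / L) := by rw [hΔr]; ring
      _ ≤ t ^ 3 / (252 * (1 + ω) ^ 3) * (ε / L) := by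
          gcongr
          rw [le_div_iff₀ (by positivity)]
          have : 0 ≤ (1 + ω) ^ 3 * r := by positivity
          linarith
      _ ≤ τ ^ 3 / (252 * (1 + ω) ^ 3) * (ε / L) := by gcongr
      _ = τ / (9 * (1 + ω) ^ 2 * (28 * (1 + ω)) * L) * τ ^ 2 * ε := by field_simp; ring
      _ ≤ _ := by
          gcongr
          · linarith
          · linarith
  · calc 243 / 2 * Δ = 243 / 2 * r * (ε / L) := by rw [hΔr]; ring
      _ ≤ 3 * t ^ 2 / (200 * (1 + ω / √(n : ℝ)) ^ 2) * (ε / L) := by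
          gcongr
          rw [le_div_iff₀ (by positivity)]
          linarith
      _ ≤ 3 * τ ^ 2 / (200 * (1 + ω / √(n : ℝ)) ^ 2) * (ε / L) := by gcongr
      _ = 3 / (200 * L * (1 + ω / √(n : ℝ)) ^ 2) * τ ^ 2 * ε := by field_simp
      _ ≤ _ := by gcongr

end GenerallyConvex

/-! ### Weights in the strongly convex case -/

section StronglyConvex

variable {n : ℕ} {L μ ω : ℝ}

lemma scθ₂_eq (hn : 1 ≤ n) (hω : 0 ≤ ω) :
    scθ₂ n ω = ω / (3 * (ω * √(n : ℝ) + n)) := by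
  have hn0 : (1 : ℝ) ≤ n := by exact_mod_cast hn
  unfold scθ₂
  split_ifs with h
  · simp [h]
  · have : 0 < ω := lt_of_le_of_ne hω (Ne.symm h)
    field_simp

lemma scη_eq (hn : 1 ≤ n) (hL : 0 < L) (hω : 0 ≤ ω) :
    scη n L ω = n / (360 * L * (ω * √(n : ℝ) + n)) := by
  have hn0 : (1 : ℝ) ≤ n := by exact_mod_cast hn
  unfold scη
  split_ifs with h
  · rw [h]
    field_simp
    simp
  · have : 0 < ω := lt_of_le_of_ne hω (Ne.symm h)
    rw [scθ₂_eq hn hω]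
    field_simp
    norm_num

lemma scη_pos (hn : 1 ≤ n) (hL : 0 < L) (hω : 0 ≤ ω) : 0 < scη n L ω := by
  have hn0 : (1 : ℝ) ≤ n := by exact_mod_cast hn
  rw [scη_eq hn hL hω]
  positivity

lemma scη_mul_le (hn : 1 ≤ n) (hL : 0 < L) (hω : 0 ≤ ω) : scη n L ω * L ≤ 1 / 360 := by
  have hn0 : (1 : ℝ) ≤ n := by exact_mod_cast hn
  have h0 : 0 ≤ ω * √(n : ℝ) := by positivity
  rw [scη_eq hn hL hω, div_mul_eq_mul_div, div_le_div_iff₀ (by positivity) (by norm_num)]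
  nlinarith

lemma scParams_admissible (hn : 1 ≤ n) (hL : 0 < L) (hμ : 0 < μ) (hω : 0 ≤ ω) (k : ℕ) :
    (scParams n L μ ω).Admissible L μ ω k where
  θ₁_pos := by simp only [scParams]; positivity
  η_pos := scη_pos hn hL hω
  η_mul_le := (scη_mul_le hn hL hω).trans (by norm_num)
  β_eq := rfl
  γ_eq := rfl
  α_eq := rfl
  p_nonneg := by simp only [scParams]; positivity
  p_le := le_rfl

/-- The communication complexity of the strongly convex case, up to the logarithm. -/
def scBudget (n : ℕ) (L μ ω : ℝ) : ℝ := ω + (1 + ω / √(n : ℝ)) * √(L / μ)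

/-- The contraction factor of the Lyapunov function is the inverse of this number. -/
def scGrowth (n : ℕ) (L μ ω : ℝ) : ℝ := 1 + 1 / (240 * scBudget n L μ ω)

/-- The part of the weight of the suboptimality of `w` that enforces a strict decrease. -/
def scSlack (n : ℕ) (L μ ω : ℝ) : ℝ :=
  (ω * √(n : ℝ) + n) / (ω * √(n : ℝ) + n + 2 * √(L / μ) * ω)

/-- The weights of the Lyapunov function in the strongly convex case. -/
def scWeights (n : ℕ) (L μ ω : ℝ) (k : ℕ) : Weights where
  z := scGrowth n L μ ω ^ k *
    ((2 * (1 / (3 * √(L / μ))) + scη n L ω * μ) ^ 2 / (4 * scη n L ω))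
  y := scGrowth n L μ ω ^ k
  w := scGrowth n L μ ω ^ k * (scθ₂ n ω * (1 + scSlack n L μ ω) * (1 + ω))
  h := scGrowth n L μ ω ^ k * (4 * (1 + ω) * (scη n L ω * (ω / n)))

lemma one_le_sqrt_ratio (hμ : 0 < μ) (hμL : μ ≤ L) : 1 ≤ √(L / μ) :=
  Real.one_le_sqrt.2 ((one_le_div hμ).2 hμL)

lemma one_add_le_scBudget (hμ : 0 < μ) (hμL : μ ≤ L) (hω : 0 ≤ ω) :
    1 + ω ≤ scBudget n L μ ω := by
  have h1 := one_le_sqrt_ratio hμ hμL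
  have h2 : 0 ≤ ω / √(n : ℝ) := by positivity
  unfold scBudget
  nlinarith

lemma scθ₂_nonneg (hn : 1 ≤ n) (hω : 0 ≤ ω) : 0 ≤ scθ₂ n ω := by
  rw [scθ₂_eq hn hω]; positivity

lemma scGrowth_pos (hμ : 0 < μ) (hμL : μ ≤ L) (hω : 0 ≤ ω) : 0 < scGrowth n L μ ω := by
  have := one_add_le_scBudget (n := n) hμ hμL hω
  have : 0 < scBudget n L μ ω := by linarith
  unfold scGrowth
  positivity

lemma scSlack_nonneg (hω : 0 ≤ ω) : 0 ≤ scSlack n L μ ω := by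
  unfold scSlack; positivity

lemma scWeights_nonneg (hn : 1 ≤ n) (hμ : 0 < μ) (hμL : μ ≤ L) (hω : 0 ≤ ω) (k : ℕ) :
    (scWeights n L μ ω k).Nonneg := by
  have h1 := scη_pos hn (hμ.trans_le hμL) hω
  have h2 := scGrowth_pos (n := n) hμ hμL hω
  have h3 := scθ₂_nonneg hn hω
  have h4 := scSlack_nonneg (n := n) (L := L) (μ := μ) hω
  constructor <;> simp only [scWeights] <;> positivity

lemma scWeights_step (hn : 1 ≤ n) (hμ : 0 < μ) (hμL : μ ≤ L) (hω : 0 ≤ ω) (k : ℕ) :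
    WeightsStep (scParams n L μ ω) n L μ ω k (scWeights n L μ ω k)
      (scWeights n L μ ω (k + 1)) := by
  have hL : 0 < L := hμ.trans_le hμL
  have hn0 : (1 : ℝ) ≤ n := by exact_mod_cast hn
  have hs1 : 1 ≤ √(n : ℝ) := Real.one_le_sqrt.2 hn0
  have hss : √(n : ℝ) * √(n : ℝ) = n := Real.mul_self_sqrt (by linarith)
  have hη := scη_pos hn hL hω
  have hc := scGrowth_pos (n := n) hμ hμL hω
  have hr1 := one_le_sqrt_ratio hμ hμL
  have hB1 := one_add_le_scBudget (n := n) hμ hμL hω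
  have hμr : μ = L / √(L / μ) ^ 2 := by
    rw [Real.sq_sqrt (by positivity)]; field_simp
  have hBdef : scBudget n L μ ω = ω + (1 + ω / √(n : ℝ)) * √(L / μ) := rfl
  have hcdef : scGrowth n L μ ω = 1 + 1 / (240 * scBudget n L μ ω) := rfl
  have hslack : scSlack n L μ ω
    = (ω * √(n : ℝ) + n) / (ω * √(n : ℝ) + n + 2 * √(L / μ) * ω) := rfl
  have hb0 := scSlack_nonneg (n := n) (L := L) (μ := μ) hω
  have hθ₂ := scθ₂_eq hn hω
  have hηe := scη_eq hn hL hω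
  obtain ⟨r, hr⟩ : ∃ r, r = √(L / μ) := ⟨_, rfl⟩
  obtain ⟨B, hB⟩ : ∃ B, B = scBudget n L μ ω := ⟨_, rfl⟩
  obtain ⟨u, hu⟩ : ∃ u : ℝ, u = ω * √(n : ℝ) + n := ⟨_, rfl⟩
  obtain ⟨b, hb⟩ : ∃ b, b = scSlack n L μ ω := ⟨_, rfl⟩
  rw [← hu] at hθ₂ hηe
  rw [← hr, ← hu, ← hb] at hslack
  rw [← hb] at hb0
  rw [← hr] at hr1
  rw [← hB] at hB1 hcdef hBdef
  rw [← hr] at hBdef hμr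
  have hωs : 0 ≤ ω * √(n : ℝ) := by positivity
  have hun : (n : ℝ) ≤ u := by linarith
  have hu0 : 0 < u := by linarith
  have huω : ω ≤ u := by nlinarith
  -- `u/n = 1 + ω/√n`, so `u r / n` is the second summand of `B`.
  have hBu : u * r ≤ B * n := by
    have h1 : (1 + ω / √(n : ℝ)) * n = u := by
      rw [add_mul, one_mul, hu, add_comm, add_left_inj, div_mul_eq_mul_div,
        div_eq_iff (by positivity), mul_assoc, hss]
    have h2 : B * n = ω * n + u * r := by rw [hBdef, ← h1]; ring
    have h3 : 0 ≤ ω * n := by positivity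
    linarith
  have hrB : r ≤ B := by
    have : 0 ≤ ω / √(n : ℝ) * r := by positivity
    rw [hBdef]; linarith
  have hB0 : 0 < B := by linarith
  have hωu : (1 + ω) * ω / u * r ≤ B := by
    have h1 : (1 + ω) * ω / u ≤ ω / √(n : ℝ) := by
      rw [div_le_div_iff₀ hu0 (by positivity), hu]
      have : √(n : ℝ) ≤ n := by nlinarith
      nlinarith
    have h2 := mul_le_mul_of_nonneg_right h1 (by linarith : 0 ≤ r)
    rw [hBdef]; linarith
  set ρ := 1 / (240 * B) with hρ
  have hρ0 : 0 < ρ := by positivity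
  -- `F1` to `F4` say that the rate `ρ` fits the contraction available to `z`, `y`, `w` and the
  -- shifts, in this order.
  have F1 : ρ * (2 * (1 / (3 * r))) ≤ scη n L ω * μ := by
    have e1 : scη n L ω * μ = n / (360 * u * r ^ 2) := by
      rw [hηe]; nth_rewrite 1 [hμr]; field_simp
    have e2 : ρ * (2 * (1 / (3 * r))) = 1 / (360 * B * r) := by
      rw [hρ]; field_simp; norm_num
    rw [e1, e2, div_le_div_iff₀ (by positivity) (by positivity)]
    have := mul_le_mul_of_nonneg_right hBu (by positivity : 0 ≤ 360 * r)
    linarith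
  have F2 : ρ ≤ 1 / (3 * r) / 2 := by
    rw [hρ, div_div, div_le_div_iff₀ (by positivity) (by positivity)]
    linarith
  have F4 : ρ ≤ 1 / (4 * (1 + ω)) := by
    rw [hρ, div_le_div_iff₀ (by positivity) (by positivity)]
    linarith
  have hb1 : b ≤ 1 := by
    rw [hslack, div_le_one (by positivity)]
    have : 0 ≤ 2 * r * ω := by positivity
    linarith
  have F3 : ρ * (2 * (1 + ω)) ≤ b := by
    rw [hslack, le_div_iff₀ (by positivity), hρ, div_mul_eq_mul_div, div_mul_eq_mul_div,
      div_le_iff₀ (by positivity)]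
    have h1 : (1 + ω) * ω * r ≤ B * u := by
      rw [div_mul_eq_mul_div, div_le_iff₀ hu0] at hωu
      linarith
    have h2 : (1 + ω) * u ≤ B * u := by gcongr
    have h3 : 0 ≤ B * u := by positivity
    linarith
  -- The slack satisfies `1/b = 1 + 2θ₂/θ₁`, a smoothed minimum of `1` and `θ₁/(2θ₂)`: `w` gains a
  -- decrease while `y` keeps half of `θ₁`.
  have hbθ : scθ₂ n ω * b ≤ 1 / (3 * r) / 2 := by
    rw [hθ₂, hslack]
    have h1 : ω / (3 * u) * (u / (u + 2 * r * ω)) = ω / (3 * (u + 2 * r * ω)) := by field_simp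
    rw [h1, div_div, div_le_div_iff₀ (by positivity) (by positivity)]
    linarith
  have hωη : scη n L ω * (ω / n) * L = ω / (360 * u) := by rw [hηe]; field_simp
  have hωu1 : ω / u ≤ 1 := (div_le_one hu0).2 huω
  have hωu0 : 0 ≤ ω / u := by positivity
  have hθ₂0 := scθ₂_nonneg hn hω
  have hθ₂u : scθ₂ n ω = ω / u / 3 := by rw [hθ₂]; field_simp
  have hωηu : scη n L ω * (ω / n) * L = ω / u / 360 := by rw [hωη]; field_simp
  have hp0 : 0 < 1 / (1 + ω) := by positivity
  have hck : 0 < scGrowth n L μ ω ^ k := pow_pos hc k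
  have hck1 : 0 < scGrowth n L μ ω ^ (k + 1) := pow_pos hc (k + 1)
  refine ⟨scWeights_nonneg hn hμ hμL hω (k + 1), rfl, ?_, ?_, ?_, ?_, ?_, ?_⟩
  all_goals simp only [scWeights, scParams]
  all_goals try rw [← hr]
  all_goals try rw [← hb]
  · rw [pow_succ, mul_assoc]
    gcongr
    rw [hcdef]
    set q := 2 * (1 / (3 * r)) + scη n L ω * μ with hq
    have hq0 : 0 < q := by positivity
    have h1 : (1 + ρ) * (2 * (1 / (3 * r))) ≤ q := by rw [hq]; linarith
    calc (1 + ρ) * (1 / (3 * r) * q / (2 * scη n L ω))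
        = (1 + ρ) * (2 * (1 / (3 * r))) * (q / (4 * scη n L ω)) := by ring
      _ ≤ q * (q / (4 * scη n L ω)) := by gcongr
      _ = _ := by ring
  · have e : scGrowth n L μ ω ^ (k + 1) * (1 - 1 / (3 * r) - scθ₂ n ω)
        + scGrowth n L μ ω ^ (k + 1) * (scθ₂ n ω * (1 + b) * (1 + ω)) * (1 / (1 + ω))
        = scGrowth n L μ ω ^ k * (scGrowth n L μ ω * (1 - 1 / (3 * r) + scθ₂ n ω * b)) := by
      field_simp; ring
    rw [e]
    refine mul_le_of_le_one_right hck.le ?_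
    calc scGrowth n L μ ω * (1 - 1 / (3 * r) + scθ₂ n ω * b)
        ≤ scGrowth n L μ ω * (1 - ρ) := by
          gcongr
          linarith
      _ = 1 - ρ ^ 2 := by rw [hcdef]; ring
      _ ≤ 1 := by linarith [sq_nonneg ρ]
  · have e : scGrowth n L μ ω ^ (k + 1) * scθ₂ n ω
        + scGrowth n L μ ω ^ (k + 1) * (scθ₂ n ω * (1 + b) * (1 + ω)) * (1 - 1 / (1 + ω))
        = scGrowth n L μ ω ^ k * (scθ₂ n ω * (scGrowth n L μ ω * ((1 + b) * (1 + ω) - b))) := by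
      field_simp; ring
    rw [e, mul_assoc (scθ₂ n ω)]
    refine mul_le_mul_of_nonneg_left (mul_le_mul_of_nonneg_left ?_ hθ₂0) hck.le
    rw [hcdef]
    have h1 := mul_le_mul_of_nonneg_left hb1 (mul_nonneg hρ0.le (by linarith : 0 ≤ 1 + ω))
    have h2 := mul_nonneg hρ0.le hb0
    linarith
  · have e : scGrowth n L μ ω ^ (k + 1) * (4 * (1 + ω) * (scη n L ω * (ω / n)))
          * (1 - 1 / (1 + ω) / 2)
        + scGrowth n L μ ω ^ (k + 1) * (scη n L ω * (ω / n))
        = scGrowth n L μ ω ^ k * ((4 * (1 + ω) * (scη n L ω * (ω / n)))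
          * (scGrowth n L μ ω * (1 - 1 / (4 * (1 + ω))))) := by
      field_simp; ring
    rw [e]
    refine mul_le_mul_of_nonneg_left (mul_le_of_le_one_right (by positivity) ?_) hck.le
    calc scGrowth n L μ ω * (1 - 1 / (4 * (1 + ω)))
        ≤ scGrowth n L μ ω * (1 - ρ) := by gcongr
      _ = 1 - ρ ^ 2 := by rw [hcdef]; ring
      _ ≤ 1 := by linarith [sq_nonneg ρ]
  -- `50 = 2 + 12 · 4`. Since `θ₂ = 120 η (ω/n) L`, the Bregman term at `w` suffices.
  · have e : scGrowth n L μ ω ^ (k + 1) * (scη n L ω * (ω / n)) * (2 * L)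
        + 12 * (1 / (1 + ω)) * L
          * (scGrowth n L μ ω ^ (k + 1) * (4 * (1 + ω) * (scη n L ω * (ω / n))))
        = scGrowth n L μ ω ^ (k + 1) * (50 * (scη n L ω * (ω / n) * L)) := by
      field_simp; ring
    rw [e, hωηu, hθ₂u]
    gcongr
    linarith
  · have e : 12 * (1 / (1 + ω)) * L
          * (scGrowth n L μ ω ^ (k + 1) * (4 * (1 + ω) * (scη n L ω * (ω / n))))
        = scGrowth n L μ ω ^ (k + 1) * (48 * (scη n L ω * (ω / n) * L)) := by
      field_simp; ring
    rw [e, hωηu, hθ₂u]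
    gcongr
    have : 1 / (3 * r) ≤ 1 / 3 := by gcongr; linarith
    linarith

lemma scWeights_initial_le {Δ : ℝ} (hn : 1 ≤ n) (hμ : 0 < μ) (hμL : μ ≤ L) (hω : 0 ≤ ω)
    (hΔ : 0 ≤ Δ) :
    ((scWeights n L μ ω 0).z + ((scWeights n L μ ω 0).y + (scWeights n L μ ω 0).w) * (L / 2)
      + (scWeights n L μ ω 0).h * L ^ 2) * Δ
      ≤ ((scWeights n L μ ω 0).y + (scWeights n L μ ω 0).w) * (542 * (L * Δ)) := by
  have hL : 0 < L := hμ.trans_le hμL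
  have hn0 : (1 : ℝ) ≤ n := by exact_mod_cast hn
  have hs1 : 1 ≤ √(n : ℝ) := Real.one_le_sqrt.2 hn0
  have hss : √(n : ℝ) * √(n : ℝ) = n := Real.mul_self_sqrt (by linarith)
  have hη := scη_pos hn hL hω
  have hr1 := one_le_sqrt_ratio hμ hμL
  have hμr : μ = L / √(L / μ) ^ 2 := by
    rw [Real.sq_sqrt (by positivity)]; field_simp
  have hηL := scη_mul_le hn hL hω
  have hb0 := scSlack_nonneg (n := n) (L := L) (μ := μ) hω
  have hθ₂ := scθ₂_eq hn hω
  have hηe := scη_eq hn hL hω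
  obtain ⟨r, hr⟩ : ∃ r, r = √(L / μ) := ⟨_, rfl⟩
  simp only [scWeights, pow_zero, one_mul]
  rw [← hr] at hr1 hμr ⊢
  set s := √(n : ℝ) with hs
  set t := ω / s with ht
  have ht0 : 0 ≤ t := by positivity
  have hωt : ω = t * s := by rw [ht]; field_simp
  set W := scθ₂ n ω * (1 + scSlack n L μ ω) * (1 + ω) with hW
  have hu : ω * s + n = n * (1 + t) := by rw [hωt, ← hss]; ring
  have hV : ω * (1 + ω) / (3 * (n * (1 + t))) ≤ W := by
    have h1 : ω * (1 + ω) / (3 * (n * (1 + t))) = scθ₂ n ω * 1 * (1 + ω) := by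
      rw [hθ₂, hu]; ring
    rw [h1, hW]
    have := scθ₂_nonneg hn hω
    gcongr
    linarith
  have hVt : t ^ 2 / (3 * (1 + t)) ≤ W := by
    refine le_trans ?_ hV
    rw [div_le_div_iff₀ (by positivity) (by positivity)]
    have h1 : t ^ 2 * n ≤ ω * (1 + ω) := by
      have : t ^ 2 * n = ω * ω := by rw [hωt, ← hss]; ring
      rw [this]; nlinarith
    have := mul_le_mul_of_nonneg_right h1 (by positivity : 0 ≤ 3 * (1 + t))
    linarith
  -- The weight of the distance may be of order `L(1 + t)`, but the weight `W` of `w` is at least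
  -- `t²/(3(1+t))`, which is linear in `t` for large `t`.
  have h6 : 1 + t ≤ 6 * (1 + W) := by
    have h1 : (1 + t) / 6 ≤ 1 + t ^ 2 / (3 * (1 + t)) := by
      have e : 1 + t ^ 2 / (3 * (1 + t)) = (3 * (1 + t) + t ^ 2) / (3 * (1 + t)) := by
        field_simp
      rw [e, div_le_div_iff₀ (by norm_num) (by positivity)]
      nlinarith
    linarith
  have hW0 : 0 ≤ W := le_trans (by positivity) hVt
  -- the weight of the distance
  have hq : 2 * (1 / (3 * r)) + scη n L ω * μ ≤ 3 * (1 / (3 * r)) := by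
    have h1 : scη n L ω * μ = scη n L ω * L / r ^ 2 := by
      nth_rewrite 1 [hμr]; ring
    have h2 : scη n L ω * L / r ^ 2 ≤ 1 / (3 * r) := by
      rw [div_le_div_iff₀ (by positivity) (by positivity)]
      have : scη n L ω * L * (3 * r) ≤ 1 / 360 * (3 * r) := by gcongr
      nlinarith
    linarith
  have hA : (2 * (1 / (3 * r)) + scη n L ω * μ) ^ 2 / (4 * scη n L ω) ≤ 540 * L * (1 + W) := by
    calc (2 * (1 / (3 * r)) + scη n L ω * μ) ^ 2 / (4 * scη n L ω)
        ≤ (3 * (1 / (3 * r))) ^ 2 / (4 * scη n L ω) := by gcongr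
      _ = 90 * L * (1 + t) / r ^ 2 := by rw [hηe, hu]; field_simp; ring
      _ ≤ 90 * L * (1 + t) := div_le_self (by positivity) (one_le_pow₀ hr1)
      _ ≤ 90 * L * (6 * (1 + W)) := by gcongr
      _ = _ := by ring
  have hM : 4 * (1 + ω) * (scη n L ω * (ω / n)) * L ^ 2 ≤ L * W := by
    have e : 4 * (1 + ω) * (scη n L ω * (ω / n)) * L ^ 2
        = L * (ω * (1 + ω) / (3 * (n * (1 + t)))) / 30 := by
      rw [hηe, hu]; field_simp; ring
    have h1 := mul_le_mul_of_nonneg_left hV hL.le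
    have h2 : 0 ≤ L * W := by positivity
    rw [e]
    linarith
  have hLW : 0 ≤ L * (1 + W) := by positivity
  calc _ ≤ (540 * L * (1 + W) + (1 + W) * (L / 2) + L * W) * Δ := by gcongr
    _ ≤ (542 * L * (1 + W)) * Δ := by
      gcongr
      linarith
    _ = _ := by ring

lemma exp_half_le_one_add {ρ : ℝ} (h0 : 0 ≤ ρ) (h1 : ρ ≤ 1) : Real.exp (ρ / 2) ≤ 1 + ρ := by
  have h2 := Real.add_one_le_exp (-(ρ / 2))
  have h3 : Real.exp (ρ / 2) * Real.exp (-(ρ / 2)) = 1 := by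
    rw [← Real.exp_add]; simp
  have h4 := Real.exp_pos (ρ / 2)
  have h5 : Real.exp (ρ / 2) * (1 - ρ / 2) ≤ 1 := by
    rw [← h3]
    gcongr
    linarith
  have h6 : 1 ≤ (1 + ρ) * (1 - ρ / 2) := by nlinarith
  exact le_of_mul_le_mul_right (h5.trans h6) (by linarith)

lemma scGrowth_pow_large {R : ℝ} (hμ : 0 < μ) (hμL : μ ≤ L) (hω : 0 ≤ ω) (hR : 2 ≤ R) {T : ℕ}
    (hT : 5280 * (scBudget n L μ ω * Real.log R) ≤ T) : 542 * R ≤ scGrowth n L μ ω ^ T := by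
  have hB := one_add_le_scBudget (n := n) hμ hμL hω
  have hB0 : 0 < scBudget n L μ ω := by linarith
  have hR0 : 0 < R := by linarith
  have h1 : Real.exp (1 / (240 * scBudget n L μ ω) / 2) ≤ scGrowth n L μ ω :=
    exp_half_le_one_add (by positivity) (by rw [div_le_one (by positivity)]; linarith)
  -- As `R ≥ 2`, ten further powers absorb `542`. Then `5280 = 11 · 240 · 2`, the last factor from
  -- `exp (ρ/2) ≤ 1 + ρ`.
  calc 542 * R ≤ R ^ 10 * R := by
        gcongr
        calc (542 : ℝ) ≤ 2 ^ 10 := by norm_num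
          _ ≤ R ^ 10 := by gcongr
    _ = Real.exp (11 * Real.log R) := by
        rw [← pow_succ, ← Real.exp_log hR0, ← Real.exp_nat_mul, Real.exp_log hR0]
        norm_num
    _ ≤ Real.exp (T * (1 / (240 * scBudget n L μ ω) / 2)) := by
        apply Real.exp_le_exp.2
        have e : 11 * Real.log R = 5280 * (scBudget n L μ ω * Real.log R)
            * (1 / (240 * scBudget n L μ ω) / 2) := by field_simp; ring
        rw [e]
        gcongr
    _ = Real.exp (1 / (240 * scBudget n L μ ω) / 2) ^ T := Real.exp_nat_mul _ _
    _ ≤ scGrowth n L μ ω ^ T := by gcongr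

end StronglyConvex

/-! ### The two rates -/

section Rates

variable {d n : ℕ} {L μ Δ ω ε : ℝ} {f : Fin n → Vec d → ℝ} {x0 xstar : Vec d}
  {h0 : Fin n → Vec d} {S : Type*} [MeasurableSpace S] {ν : Measure S} [IsProbabilityMeasure ν]
  {C : Fin n → Vec d → S → Vec d} {Ω : Type*} [MeasurableSpace Ω] {P : Measure Ω}
  [IsProbabilityMeasure P] {ξ ξ' : ℕ → Ω → S} {b : ℕ → Ω → Bool}

lemma initial_gap_le (hn : 1 ≤ n) (hL : 0 ≤ L) (hε : 0 < ε)
    (hf : ∀ i, IsSmoothConvex L μ (f i)) (hmin : ∀ x, objective f xstar ≤ objective f x)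
    (hΔ : ‖x0 - xstar‖ ^ 2 ≤ Δ) (hr : L * Δ / ε ≤ 2) :
    objective f x0 - objective f xstar ≤ ε := by
  have h1 := objective_sub_minimizer_le hn hL hf hmin x0
  have h2 : L / 2 * ‖x0 - xstar‖ ^ 2 ≤ L / 2 * Δ := by gcongr
  rw [div_le_iff₀ hε] at hr
  linarith

theorem stronglyConvex_rate (hn : 1 ≤ n) (hμ : 0 < μ) (hμL : μ ≤ L) (hΔ0 : 0 ≤ Δ) (hω : 0 ≤ ω)
    (hε : 0 < ε) (hf : ∀ i, IsSmoothConvex L μ (f i))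
    (hmin : ∀ x, objective f xstar ≤ objective f x) (hΔ : ‖x0 - xstar‖ ^ 2 ≤ Δ)
    (hh : (1 / (n : ℝ)) * ∑ i, ‖h0 i - gradient (f i) x0‖ ^ 2 ≤ L ^ 2 * Δ)
    (hC : IsIndepUnbiased ω ν C) (hr : IsRandomness P ν (scParams n L μ ω).p ξ ξ' b) :
    ∃ T : ℕ, (communicationRounds T : ℝ) ≤
        11000 * ((ω + (1 + ω / √(n : ℝ)) * √(L / μ)) * max (Real.log (L * Δ / ε)) 0) ∧
      IsAccurate P (scParams n L μ ω) f C x0 h0 ξ ξ' b xstar ε T := by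
  have hL : 0 < L := hμ.trans_le hμL
  -- If `LΔ/ε ≤ 2`, the starting point is accurate because its gap is at most `LΔ/2`. Otherwise the
  -- logarithm is at least `1/2` and the bound absorbs rounding up `T`.
  rcases le_or_gt (L * Δ / ε) 2 with hR | hR
  · refine ⟨0, ?_, isAccurate_zero (initial_gap_le hn hL.le hε hf hmin hΔ hR)⟩
    simp only [communicationRounds, mul_zero, Nat.cast_zero]
    positivity
  · have hB := one_add_le_scBudget (n := n) hμ hμL hω
    have hBdef : ω + (1 + ω / √(n : ℝ)) * √(L / μ) = scBudget n L μ ω := rfl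
    set R := L * Δ / ε with hRdef
    have hlog2 : 1 / 2 ≤ Real.log R := by
      have h1 := Real.log_two_gt_d9
      have h2 := Real.log_le_log (by norm_num) hR.le
      linarith
    have hBl : 1 / 2 ≤ scBudget n L μ ω * Real.log R := by nlinarith
    rw [max_eq_left (by linarith), hBdef]
    refine ⟨⌈5280 * (scBudget n L μ ω * Real.log R)⌉₊, ?_, ?_⟩
    · have h1 := Nat.ceil_lt_add_one
        (by positivity : 0 ≤ 5280 * (scBudget n L μ ω * Real.log R))
      simp only [communicationRounds]
      push_cast
      linarith
    · set T := ⌈5280 * (scBudget n L μ ω * Real.log R)⌉₊ with hT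
      have hpow := scGrowth_pow_large (n := n) hμ hμL hω hR.le
        (Nat.le_ceil (5280 * (scBudget n L μ ω * Real.log R)))
      rw [← hT] at hpow
      have ha0 := scWeights_nonneg hn hμ hμL hω 0
      have hyw : ∀ k, (scWeights n L μ ω k).y + (scWeights n L μ ω k).w
          = scGrowth n L μ ω ^ k * ((scWeights n L μ ω 0).y + (scWeights n L μ ω 0).w) := by
        intro k
        simp only [scWeights, pow_zero]
        ring
      have hyw0 : 0 < (scWeights n L μ ω 0).y + (scWeights n L μ ω 0).w := by
        have h1 : (scWeights n L μ ω 0).y = 1 := pow_zero _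
        have h2 := ha0.w
        linarith
      refine isAccurate_of_weights hC hn hL hμ.le hω hf hmin
        (fun k => scParams_admissible hn hL hμ hω k) ha0
        (fun k => scWeights_step hn hμ hμL hω k) x0 h0 hr T ?_ ?_
      · rw [hyw]
        exact mul_pos (pow_pos (scGrowth_pos hμ hμL hω) _) hyw0
      · refine (lyapunov_initial_le hn hL.le hf hmin hΔ hh ha0 _).trans
          ((scWeights_initial_le hn hμ hμL hω hΔ0).trans ?_)
        have h1 : L * Δ = R * ε := by rw [hRdef]; field_simp
        rw [hyw T, h1]
        calc ((scWeights n L μ ω 0).y + (scWeights n L μ ω 0).w) * (542 * (R * ε))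
            = 542 * R * ((scWeights n L μ ω 0).y + (scWeights n L μ ω 0).w) * ε := by ring
          _ ≤ scGrowth n L μ ω ^ T
                * ((scWeights n L μ ω 0).y + (scWeights n L μ ω 0).w) * ε := by gcongr

theorem generallyConvex_rate (hn : 1 ≤ n) (hL : 0 ≤ L) (hΔ0 : 0 ≤ Δ) (hω : 0 ≤ ω)
    (hε : 0 < ε) (hf : ∀ i, IsSmoothConvex L 0 (f i))
    (hmin : ∀ x, objective f xstar ≤ objective f x) (hΔ : ‖x0 - xstar‖ ^ 2 ≤ Δ)
    (hh : (1 / (n : ℝ)) * ∑ i, ‖h0 i - gradient (f i) x0‖ ^ 2 ≤ L ^ 2 * Δ)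
    (hC : IsIndepUnbiased ω ν C) (hr : IsRandomness P ν (gcParams n L ω).p ξ ξ' b) :
    ∃ T : ℕ, (communicationRounds T : ℝ) ≤
        182 * ((1 + ω) * (L * Δ / ε) ^ (1 / 3 : ℝ) + (1 + ω / √(n : ℝ)) * √(L * Δ / ε)) ∧
      IsAccurate P (gcParams n L ω) f C x0 h0 ξ ξ' b xstar ε T := by
  rcases le_or_gt (L * Δ / ε) 2 with hR | hR
  · refine ⟨0, ?_, isAccurate_zero (initial_gap_le hn hL hε hf hmin hΔ hR)⟩
    simp only [communicationRounds, mul_zero, Nat.cast_zero]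
    positivity
  · have hL' : 0 < L := by
      refine lt_of_le_of_ne hL fun h => ?_
      rw [← h] at hR
      norm_num at hR
    set B := (1 + ω) * (L * Δ / ε) ^ (1 / 3 : ℝ) + (1 + ω / √(n : ℝ)) * √(L * Δ / ε) with hB
    have hB1 : 1 ≤ B := by
      have h1 : 1 ≤ (L * Δ / ε) ^ (1 / 3 : ℝ) := Real.one_le_rpow (by linarith) (by norm_num)
      have h2 : 0 ≤ (1 + ω / √(n : ℝ)) * √(L * Δ / ε) := by positivity
      nlinarith
    have hT := Nat.le_ceil (90 * B)
    have hT' := Nat.ceil_lt_add_one (by positivity : 0 ≤ 90 * B)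
    refine ⟨⌈90 * B⌉₊, ?_, ?_⟩
    · simp only [communicationRounds]
      push_cast
      linarith
    · have hT1 : 1 ≤ ⌈90 * B⌉₊ := Nat.one_le_ceil_iff.2 (by linarith)
      set T := ⌈90 * B⌉₊ with hTdef
      have ha0 := gcWeights_nonneg (n := n) hn hL' hω 0
      have hy : (gcWeights n L ω T).y = gcLambda n L ω (T - 1) := rfl
      have hl := gcLambda_pos hn hL' hω (T - 1)
      have hw : (gcWeights n L ω T).y ≤ (gcWeights n L ω T).w := by
        simp only [gcWeights]
        refine le_mul_of_one_le_right hl.le ?_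
        have h1 : 0 ≤ (T : ℝ) + 27 * (1 + ω) - 1 := by
          have : (0 : ℝ) ≤ T := by positivity
          linarith
        have : 0 ≤ 15 * (1 + ω) / ((T : ℝ) + 27 * (1 + ω) - 1) := by positivity
        linarith
      refine isAccurate_of_weights hC hn hL' le_rfl hω hf hmin
        (fun k => gcParams_admissible hn hL' hω k) ha0
        (fun k => gcWeights_step hn hL' hω k) x0 h0 hr T ?_ ?_
      · linarith
      · refine (lyapunov_initial_le hn hL hf hmin hΔ hh ha0 _).trans
          ((gcWeights_initial_le hn hL' hω hΔ0).trans
            ((gcLambda_large hn hL' hω hΔ0 hε hT1 hT).trans ?_))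
        gcongr
        linarith

end Rates

end ADIANA

end
theorem theorem3 :
    ∃ K : ℝ, 0 < K ∧
      ∀ (d n : ℕ) (L μ Δ ω ε : ℝ), 1 ≤ n → 0 ≤ μ → μ ≤ L → 0 ≤ Δ → 0 ≤ ω → 0 < ε →
      -- the local functions, a global minimizer, the starting point and the initial shifts
      ∀ (f : Fin n → ADIANA.Vec d → ℝ) (x0 xstar : ADIANA.Vec d) (h0 : Fin n → ADIANA.Vec d),
      (∀ i, ADIANA.IsSmoothConvex L μ (f i)) →
      (∀ x, ADIANA.objective f xstar ≤ ADIANA.objective f x) →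
      ‖x0 - xstar‖ ^ 2 ≤ Δ →
      (1 / (n : ℝ)) * ∑ i, ‖h0 i - gradient (f i) x0‖ ^ 2 ≤ L ^ 2 * Δ →
      -- independent unbiased compressors
      ∀ (S : Type*) [MeasurableSpace S] (ν : MeasureTheory.Measure S)
        [MeasureTheory.IsProbabilityMeasure ν]
        (C : Fin n → ADIANA.Vec d → S → ADIANA.Vec d),
      ADIANA.IsIndepUnbiased ω ν C →
      -- the probability space and the random inputs of the run
      ∀ (Ω : Type*) [MeasurableSpace Ω] (P : MeasureTheory.Measure Ω)
        [MeasureTheory.IsProbabilityMeasure P] (ξ ξ' : ℕ → Ω → S) (b : ℕ → Ω → Bool),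
      -- strongly convex case
      (0 < μ → ADIANA.IsRandomness P ν (ADIANA.scParams n L μ ω).p ξ ξ' b →
        ∃ T : ℕ,
          (ADIANA.communicationRounds T : ℝ) ≤
            K * ((ω + (1 + ω / √(n : ℝ)) * √(L / μ)) * max (Real.log (L * Δ / ε)) 0) ∧
          ADIANA.IsAccurate P (ADIANA.scParams n L μ ω) f C x0 h0 ξ ξ' b xstar ε T) ∧
      -- generally convex case
      (μ = 0 → ADIANA.IsRandomness P ν (ADIANA.gcParams n L ω).p ξ ξ' b →
        ∃ T : ℕ,
          (ADIANA.communicationRounds T : ℝ) ≤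
            K * ((1 + ω) * (L * Δ / ε) ^ (1 / 3 : ℝ) +
              (1 + ω / √(n : ℝ)) * √(L * Δ / ε)) ∧
          ADIANA.IsAccurate P (ADIANA.gcParams n L ω) f C x0 h0 ξ ξ' b xstar ε T) := by
  refine ⟨11000, by norm_num, ?_⟩
  intro d n L μ Δ ω ε hn hμ hμL hΔ0 hω hε f x0 xstar h0 hf hmin hΔ hh S _ ν _ C hC Ω _ P _ ξ ξ' b
  refine ⟨fun hμ0 hr => ADIANA.stronglyConvex_rate hn hμ0 hμL hΔ0 hω hε hf hmin hΔ hh hC hr,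
    fun hμ0 hr => ?_⟩
  subst hμ0
  obtain ⟨T, hT, hacc⟩ :=
    ADIANA.generallyConvex_rate hn hμL hΔ0 hω hε hf hmin hΔ hh hC hr
  refine ⟨T, hT.trans ?_, hacc⟩
  gcongr
  norm_num
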